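/- Let $K$ be a field of characteristic zero; "algebra" means associative unital $K$-algebra, and $[x_1,x_2]=x_1x_2-x_2x_1$, $[x_1,\dots,x_i]=[[x_1,\dots,x_{i-1}],x_i]$. Let $p\ge 1$, and let $\mathfrak R$ be a variety of algebras (the class of all algebras satisfying a given set of polynomial identities) contained in the variety $\mathfrak N_p$ of algebras satisfying $[x_1,\dots,x_{p+1}]=0$. Let $G$ be a group and $V$ a finite dimensional $K$-linear representation of $G$ (for example, a linear algebraic group and a rational $G$-module). Let $F=F(\mathfrak R,V)$ be the relatively free algebra in $\mathfrak R$ generated by a basis of $V$, i.e. the quotient of the tensor algebra $T(V)$ by the T-ideal of identities of $\mathfrak R$, graded so that its degree $d$ component $F_d$ is the image of $T^d(V)=V^{\otimes d}$, and let $\nu:T(V)\to F$ be the natural surjection. For $d\ge 1$ let $V^{[d]}\subseteq T(V)$ be the subspace spanned by the commutators $[v_1,\dots,v_d]$, $v_1,\dots,v_d\in V$ (so $V^{[1]}=V$), put $V^{[\le p]}=\bigoplus_{d=1}^pV^{[d]}$, and let $T=T(V^{[\le p]})$ and $S=S(V^{[\le p]})$ be its tensor algebra and its symmetric algebra. Both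 are $\mathbb N_0^p$-graded by giving the elements of $V^{[i]}\subseteq V^{[\le p]}$ the $i$-th standard basis vector as multidegree. The group $G$ acts on $V^{[\le p]}$, $T$, $S$ and $F$ in the way induced by its action on $V$; a superscript $G$ denotes the subalgebra of $G$-invariants. Let $\pi_F:T\to F$ be the composition of $\nu$ with the algebra homomorphism $T\to T(V)$ that extends the tautological map $V^{[\le p]}\to T(V)$. For $\alpha\in\mathbb N_0^p$ with $|\alpha|=\sum_i\alpha_i$ let $\iota_\alpha:S_\alpha\to T_\alpha$ be the symmetrization map, the linear map with $$\iota_\alpha(w_1\cdots w_{|\alpha|})=\frac1{|\alpha|!}\sum_{\sigma\in\mathrm{Sym}_{|\alpha|}}w_{\sigma(1)}\otimes\cdots\otimes w_{\sigma(|\alpha|)}.$$ Let $\{f_\lambda\mid\lambda\in\Lambda\}$ be a generating system of the $K$-algebra $S^G$ such that each $f_\lambda$ is multihomogeneous, $f_\lambda\in S_{\alpha_\lambda}$ with $\alpha_\lambda=(\alpha_{\lambda,1},\dots,\alpha_{\lambda,p})$, and put $\widehat f_\lambda:=\iota_{\alpha_\lambda}(f_\lambda)$. Then $\widehat f_\lambda\in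 T_{\alpha_\lambda}^G$ for all $\lambda\in\Lambda$, and the $K$-algebra $F^G$ is generated by $\{\pi_F(\widehat f_\lambda)\mid\lambda\in\Lambda\}$. Moreover, each $\pi_F(\widehat f_\lambda)$ is homogeneous of degree $\sum_{i=1}^p i\,\alpha_{\lambda,i}$: it lies in $F_d$ for $d=\sum_{i=1}^p i\,\alpha_{\lambda,i}$, and if it is non-zero, it lies in $F_d$ for no other $d$. -/

import Mathlib

universe u v w x

noncomputable section

namespace RelFreeInv

/-! ### Varieties and relatively free algebras -/

/-- The left-normed commutator `[a₀, a₁, …, aₙ] = [[a₀, …, aₙ₋₁], aₙ]`, of length `n + 1`. -/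
def leftNormed {A : Type*} [Ring A] (a : ℕ → A) : ℕ → A
  | 0 => a 0
  | n + 1 => leftNormed a n * a (n + 1) - a (n + 1) * leftNormed a n

/-- The (unital, associative) `K`-algebra `A` satisfies all the polynomial identities `f = 0`,
`f ∈ I`; the elements of `I` are polynomials in noncommuting variables `x₀, x₁, …`.
The algebras satisfying `I` form the variety defined by `I`. -/
def Satisfies {K : Type u} [Field K] (I : Set (FreeAlgebra K ℕ)) (A : Type*) [Ring A]
    [Algebra K A] : Prop :=
  ∀ f ∈ I, ∀ a : ℕ → A, FreeAlgebra.lift K a f = 0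

/-- The variety defined by the identities `I` is contained in the variety defined by `J`. -/
def VarietyLE {K : Type u} [Field K] (I J : Set (FreeAlgebra K ℕ)) : Prop :=
  ∀ (A : Type u) [Ring A] [Algebra K A], Satisfies I A → Satisfies J A

/-- The identity `[x₀, x₁, …, x_p]` (a commutator of length `p + 1`) defining the variety of Lie
nilpotent algebras of index at most `p`. -/
def lieNilpotent (K : Type u) [Field K] (p : ℕ) : Set (FreeAlgebra K ℕ) :=
  {leftNormed (FreeAlgebra.ι K) p}

section Spaces

variable {K : Type u} [Field K] {V : Type v} [AddCommGroup V] [Module K V]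

/-- The relation identifying with `0` every value `f(t₀, t₁, …)` in `T(V)` of an identity
`f ∈ I`. -/
inductive IdRel (I : Set (FreeAlgebra K ℕ)) (V : Type v) [AddCommGroup V] [Module K V] :
    TensorAlgebra K V → TensorAlgebra K V → Prop
  | of (f : FreeAlgebra K ℕ) (hf : f ∈ I) (t : ℕ → TensorAlgebra K V) :
      IdRel I V (FreeAlgebra.lift K t f) 0

/-- The relatively free algebra generated by (a basis of) `V` in the variety defined by `I`: the
quotient of `T(V)` by the T-ideal generated by the identities `I`. -/
abbrev RelFree (I : Set (FreeAlgebra K ℕ)) (V : Type v) [AddCommGroup V] [Module K V] :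
    Type (max u v) :=
  RingQuot (IdRel I V)

/-- The natural surjection `ν : T(V) → F`. -/
def nu (I : Set (FreeAlgebra K ℕ)) (V : Type v) [AddCommGroup V] [Module K V] :
    TensorAlgebra K V →ₐ[K] RelFree I V :=
  RingQuot.mkAlgHom K (IdRel I V)

/-- The degree `d` homogeneous component of `F`, the image of `T^d(V)`. -/
def relFreeDeg (I : Set (FreeAlgebra K ℕ)) (V : Type v) [AddCommGroup V] [Module K V] (d : ℕ) :
    Submodule K (RelFree I V) :=
  (LinearMap.range (TensorAlgebra.ι K : V →ₗ[K] TensorAlgebra K V) ^ d).map (nu I V).toLinearMap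

/-- `commSpace K V i` is the subspace `V^{[i+1]}` of `T(V)` spanned by the commutators
`[v₀, …, v_i]` of length `i + 1` of elements of `V`. -/
def commSpace (K : Type u) [Field K] (V : Type v) [AddCommGroup V] [Module K V] (i : ℕ) :
    Submodule K (TensorAlgebra K V) :=
  Submodule.span K
    (Set.range fun v : ℕ → V => leftNormed (fun j => TensorAlgebra.ι K (v j)) i)

/-- `V^{[≤p]}`, the (finite) direct sum of `V^{[1]}, …, V^{[p]}`. -/
abbrev CommSum (K : Type u) [Field K] (V : Type v) [AddCommGroup V] [Module K V] (p : ℕ) :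
    Type (max u v) :=
  (i : Fin p) → commSpace K V i

/-- The algebra `T = T(V^{[≤p]})`. -/
abbrev TAlg (K : Type u) [Field K] (V : Type v) [AddCommGroup V] [Module K V] (p : ℕ) :
    Type (max u v) :=
  TensorAlgebra K (CommSum K V p)

/-- The algebra `S = S(V^{[≤p]})`. -/
abbrev SAlg (K : Type u) [Field K] (V : Type v) [AddCommGroup V] [Module K V] (p : ℕ) :
    Type (max u v) :=
  SymmetricAlgebra K (CommSum K V p)

/-- The inclusion of the `i`-th summand in `V^{[≤p]}`. -/
def incl (p : ℕ) (i : Fin p) : commSpace K V i →ₗ[K] CommSum K V p :=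
  LinearMap.single K (fun i : Fin p => commSpace K V i) i

/-- `π : T → T(V)`, extending the tautological map `V^{[≤p]} → T(V)`. -/
def piT (K : Type u) [Field K] (V : Type v) [AddCommGroup V] [Module K V] (p : ℕ) :
    TAlg K V p →ₐ[K] TensorAlgebra K V :=
  TensorAlgebra.lift K
    (∑ i : Fin p, (commSpace K V i).subtype.comp (LinearMap.proj i))

/-- `π_F = ν ∘ π : T → F`. -/
def piF (I : Set (FreeAlgebra K ℕ)) (V : Type v) [AddCommGroup V] [Module K V] (p : ℕ) :
    TAlg K V p →ₐ[K] RelFree I V :=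
  (nu I V).comp (piT K V p)

/-! ### Multigradings -/

/-- The component of multidegree `α` in `T`, spanned by the products `w₁ ⋯ w_n` where each `w_j` is
in one of the summands of `V^{[≤p]}`, exactly `α i` of them in the `i`-th one (that is, in
`V^{[i+1]}`, as `i` is counted from `0`). -/
def TMulti (K : Type u) [Field K] (V : Type v) [AddCommGroup V] [Module K V] {p : ℕ}
    (α : Fin p → ℕ) : Submodule K (TAlg K V p) :=
  Submodule.span K {x | ∃ (n : ℕ) (c : Fin n → Fin p) (w : (j : Fin n) → commSpace K V (c j)),
    (∀ i, (Finset.univ.filter fun j => c j = i).card = α i) ∧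
    x = (List.ofFn fun j => TensorAlgebra.ι K (incl p (c j) (w j))).prod}

/-- The component of multidegree `α` in `S`, spanned by the products `w₁ ⋯ w_n` where each `w_j` is
in one of the summands of `V^{[≤p]}`, exactly `α i` of them in the `i`-th one. -/
def SMulti (K : Type u) [Field K] (V : Type v) [AddCommGroup V] [Module K V] {p : ℕ}
    (α : Fin p → ℕ) : Submodule K (SAlg K V p) :=
  Submodule.span K {x | ∃ (n : ℕ) (c : Fin n → Fin p) (w : (j : Fin n) → commSpace K V (c j)),
    (∀ i, (Finset.univ.filter fun j => c j = i).card = α i) ∧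
    x = ∏ j, SymmetricAlgebra.ι K (CommSum K V p) (incl p (c j) (w j))}

end Spaces

/-! ### Symmetrization -/

section Symmetrization

variable (K : Type u) [Field K] (W : Type v) [AddCommGroup W] [Module K W]

/-- The average `(1/n!) ∑_σ w_{σ(1)} ⊗ ⋯ ⊗ w_{σ(n)}`, as a multilinear map. -/
def symAvg (n : ℕ) : MultilinearMap K (fun _ : Fin n => W) (TensorAlgebra K W) :=
  ((n.factorial : K)⁻¹) •
    ∑ σ : Equiv.Perm (Fin n), (TensorAlgebra.tprod K W n).domDomCongr σ

theorem symAvg_apply (n : ℕ) (w : Fin n → W) :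
    symAvg K W n w = ((n.factorial : K)⁻¹) •
      ∑ σ : Equiv.Perm (Fin n), (List.ofFn fun j => TensorAlgebra.ι K (w (σ j))).prod := by
  simp [symAvg, TensorAlgebra.tprod_apply]

theorem symAvg_perm (n : ℕ) (w : Fin n → W) (τ : Equiv.Perm (Fin n)) :
    symAvg K W n (w ∘ τ) = symAvg K W n w := by
  rw [symAvg_apply, symAvg_apply]
  congr 1
  exact Fintype.sum_equiv (Equiv.mulLeft τ) _ _ fun σ => rfl

/-- There is a linear map `S(W) → T(W)` with
`w₁ ⋯ w_n ↦ (1/n!) ∑_σ w_{σ(1)} ⊗ ⋯ ⊗ w_{σ(n)}`. It is unique since the products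
`w₁ ⋯ w_n` span `S(W)`. -/
theorem exists_symmetrization :
    ∃ s : SymmetricAlgebra K W →ₗ[K] TensorAlgebra K W, ∀ (n : ℕ) (w : Fin n → W),
      s (∏ j, SymmetricAlgebra.ι K W (w j)) = ((n.factorial : K)⁻¹) •
        ∑ σ : Equiv.Perm (Fin n), (List.ofFn fun j => TensorAlgebra.ι K (w (σ j))).prod := by
  classical
  let b := Module.Basis.ofVectorSpace K W
  let e := SymmetricAlgebra.equivMvPolynomial b
  let val : (Module.Basis.ofVectorSpaceIndex K W →₀ ℕ) → TensorAlgebra K W := fun m =>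
    symAvg K W m.toMultiset.toList.length fun j => b (m.toMultiset.toList.get j)
  let s : SymmetricAlgebra K W →ₗ[K] TensorAlgebra K W :=
    ((MvPolynomial.basisMonomials (Module.Basis.ofVectorSpaceIndex K W) K).constr K val).comp
      e.toLinearMap
  have key : ∀ (n : ℕ) (x : Fin n → Module.Basis.ofVectorSpaceIndex K W)
      (l : List (Module.Basis.ofVectorSpaceIndex K W)), (l : Multiset _) = Finset.univ.val.map x →
      symAvg K W l.length (fun j => b (l.get j)) = symAvg K W n (fun j => b (x j)) := by
    intro n x l h
    have hlen : l.length = n := by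
      have := congrArg Multiset.card h
      simpa using this
    subst hlen
    have h2 : Finset.univ.val.map l.get = Finset.univ.val.map x := by
      rw [← h, Fin.univ_val_map, List.ofFn_get]
    have hc : ∀ c, Nonempty ({j // l.get j = c} ≃ {j // x j = c}) := fun c => by
      refine ⟨Fintype.equivOfCardEq ?_⟩
      have := congrArg (Multiset.count c) h2
      rw [Multiset.count_map, Multiset.count_map] at this
      rw [Fintype.card_subtype, Fintype.card_subtype]
      simpa [Finset.card, eq_comm] using this
    let τ : Equiv.Perm (Fin l.length) := Equiv.ofFiberEquiv fun c => (hc c).some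
    have hτ : ∀ j, x (τ j) = l.get j := Equiv.ofFiberEquiv_map _
    have : (fun j => b (l.get j)) = (fun j => b (x j)) ∘ τ := by
      funext j
      exact congrArg b (hτ j).symm
    rw [this, symAvg_perm]
  refine ⟨s, fun n w => ?_⟩
  rw [← symAvg_apply]
  have hext : s.compMultilinearMap ((MultilinearMap.mkPiAlgebra K (Fin n)
      (SymmetricAlgebra K W)).compLinearMap fun _ => SymmetricAlgebra.ι K W) = symAvg K W n := by
    refine Module.Basis.ext_multilinear (fun _ => b) fun x => ?_
    have h1 : e (∏ j, SymmetricAlgebra.ι K W (b (x j))) =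
        MvPolynomial.monomial (∑ j, Finsupp.single (x j) 1) 1 := by
      rw [map_prod, MvPolynomial.monomial_sum_one]
      exact Finset.prod_congr rfl fun j _ => SymmetricAlgebra.equivMvPolynomial_ι_apply b (x j)
    have h2 : s (∏ j, SymmetricAlgebra.ι K W (b (x j))) = val (∑ j, Finsupp.single (x j) 1) := by
      change ((MvPolynomial.basisMonomials _ K).constr K val) (e _) = _
      rw [h1]
      exact Module.Basis.constr_basis (MvPolynomial.basisMonomials _ K) K val _
    have h3 := key n x (∑ j, Finsupp.single (x j) 1 : _ →₀ ℕ).toMultiset.toList (by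
      rw [Multiset.coe_toList, map_sum]
      simp only [Finsupp.toMultiset_single, one_smul]
      have hm := Multiset.sum_map_singleton (Finset.univ.val.map x)
      rwa [Multiset.map_map] at hm)
    simpa using h2.trans h3
  simpa using congrArg (fun f => f w) hext

/-- The symmetrization map `S(W) → T(W)`,
`w₁ ⋯ w_n ↦ (1/n!) ∑_σ w_{σ(1)} ⊗ ⋯ ⊗ w_{σ(n)}`. -/
def symmetrization : SymmetricAlgebra K W →ₗ[K] TensorAlgebra K W :=
  Classical.choose (exists_symmetrization K W)

theorem symmetrization_prod (n : ℕ) (w : Fin n → W) :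
    symmetrization K W (∏ j, SymmetricAlgebra.ι K W (w j)) = ((n.factorial : K)⁻¹) •
      ∑ σ : Equiv.Perm (Fin n), (List.ofFn fun j => TensorAlgebra.ι K (w (σ j))).prod :=
  Classical.choose_spec (exists_symmetrization K W) n w

end Symmetrization

/-! ### Induced actions and invariants -/

section Actions

variable {K : Type u} [Field K] {V : Type v} [AddCommGroup V] [Module K V]

/-- The endomorphism of `T(W)` induced by a linear endomorphism of `W`. -/
def tensorMap {W : Type*} [AddCommGroup W] [Module K W] (g : W →ₗ[K] W) :
    TensorAlgebra K W →ₐ[K] TensorAlgebra K W :=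
  TensorAlgebra.lift K ((TensorAlgebra.ι K).comp g)

/-- The endomorphism of `S(W)` induced by a linear endomorphism of `W`. -/
def symMap {W : Type*} [AddCommGroup W] [Module K W] (g : W →ₗ[K] W) :
    SymmetricAlgebra K W →ₐ[K] SymmetricAlgebra K W :=
  SymmetricAlgebra.lift ((SymmetricAlgebra.ι K W).comp g)

theorem map_leftNormed {A B : Type*} [Ring A] [Ring B] [Algebra K A] [Algebra K B]
    (φ : A →ₐ[K] B) (a : ℕ → A) (n : ℕ) :
    φ (leftNormed a n) = leftNormed (fun j => φ (a j)) n := by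
  induction n with
  | zero => rfl
  | succ n ih => simp [leftNormed, ih]

theorem tensorMap_mem_commSpace (g : V →ₗ[K] V) (i : ℕ) :
    ∀ x ∈ commSpace K V i, (tensorMap g).toLinearMap x ∈ commSpace K V i := by
  intro x hx
  have : commSpace K V i ≤ (commSpace K V i).comap (tensorMap g).toLinearMap := by
    refine Submodule.span_le.mpr ?_
    rintro _ ⟨v, rfl⟩
    refine Submodule.subset_span ⟨fun j => g (v j), ?_⟩
    simp [map_leftNormed, tensorMap]
  exact this hx

/-- The endomorphism of `V^{[≤p]}` induced by a linear endomorphism of `V`. -/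
def commSumMap (p : ℕ) (g : V →ₗ[K] V) : CommSum K V p →ₗ[K] CommSum K V p :=
  LinearMap.pi fun i : Fin p =>
    ((tensorMap g).toLinearMap.restrict (tensorMap_mem_commSpace g i)).comp (LinearMap.proj i)

/-- The endomorphism of the relatively free algebra induced by a linear endomorphism of `V`. -/
def relFreeMap (I : Set (FreeAlgebra K ℕ)) (g : V →ₗ[K] V) : RelFree I V →ₐ[K] RelFree I V :=
  RingQuot.liftAlgHom K ⟨(nu I V).comp (tensorMap g), by
    rintro _ _ ⟨f, hf, t⟩
    have h : tensorMap g (FreeAlgebra.lift K t f) =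
        FreeAlgebra.lift K (fun j => tensorMap g (t j)) f := by
      have : (tensorMap g).comp (FreeAlgebra.lift K t) =
          FreeAlgebra.lift K (fun j => tensorMap g (t j)) := by
        ext j
        simp
      exact congrArg (fun φ => φ f) this
    rw [AlgHom.comp_apply, h, map_zero]
    exact (RingQuot.mkAlgHom_rel K (IdRel.of f hf _)).trans (map_zero _)⟩

/-- The subalgebra of the elements fixed by all the endomorphisms `φ g`. -/
def fixedSubalgebra {G : Type w} {A : Type*} [Semiring A] [Algebra K A] (φ : G → A →ₐ[K] A) :
    Subalgebra K A :=
  ⨅ g : G, AlgHom.equalizer (φ g) (AlgHom.id K A)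

theorem mem_fixedSubalgebra {G : Type w} {A : Type*} [Semiring A] [Algebra K A]
    (φ : G → A →ₐ[K] A) (x : A) : x ∈ fixedSubalgebra φ ↔ ∀ g, φ g x = x := by
  simp [fixedSubalgebra, Algebra.mem_iInf, AlgHom.mem_equalizer]

variable {G : Type w} [Group G] (ρ : Representation K G V)

/-- `T^G` for `T = T(V^{[≤p]})`. -/
def TInv (p : ℕ) : Subalgebra K (TAlg K V p) :=
  fixedSubalgebra fun g => tensorMap (commSumMap p (ρ g))

/-- `S^G` for `S = S(V^{[≤p]})`. -/
def SInv (p : ℕ) : Subalgebra K (SAlg K V p) :=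
  fixedSubalgebra fun g => symMap (commSumMap p (ρ g))

/-- `F^G` for the relatively free algebra `F` generated by `V`. -/
def FInv (I : Set (FreeAlgebra K ℕ)) : Subalgebra K (RelFree I V) :=
  fixedSubalgebra fun g => relFreeMap I (ρ g)

end Actions

end RelFreeInv

end

/-!
Let `L` be the image of `V^{[≤p]}` in the relatively free algebra `F`. Commutators of more than `p`
elements vanish in `F`, so `L` is a Lie subalgebra (`lieImage_bracket`), and a product of elements
of `L` depends on the order of the factors only up to products of fewer factors. Hence the linear
map `Φ : S(V^{[≤p]}) → F` given by symmetrization (`symToRelFree`) is surjective, compatibly with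
the filtrations by the number of factors (`lower_lieImage_le_map`), and multiplicative modulo
products of fewer factors (`symToRelFree_mul_sub_mem_lower`).

The group `G` is arbitrary, so invariants do not lift along equivariant surjections in general.
They do lift along `Φ`, because `Φ` commutes with the action of every endomorphism of `V`, and
the functors of `V` concerned are polynomial. Indeed, the Schur algebra of the endomorphisms of
`V^{⊗d}` commuting with permutations is semisimple by Maschke's theorem
(`isSemisimpleRing_schurAlgebra`) and spanned by the `g ⊗ ⋯ ⊗ g` (`mem_span_range_tpow`, by
polarization). Every degree of `S(V^{[≤p]})` is a natural image of a sum of copies of tensor powers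
of `V` (`symDeg_le_iSup_natDeg`), and there the kernel of the map to `F` has a natural complement,
which provides the lift (`exists_invariant_lift`, `exists_invariant_mem_symLT`).

The generation statement follows by induction on the number of factors
(`adjoin_symToRelFree_eq_FInv`): the image of an invariant of degree `n` agrees with a polynomial
in the images of the generators up to an invariant in the span of shorter products, and the
latter is the image of an invariant of degree less than `n`.

Different degrees of `F` are independent since the scalar `2` acts on them with different
eigenvalues (`iSupIndep_scaleSpace`).
-/

namespace RelFreeInv

open scoped TensorProduct

/-! ### Polarization -/

/-- Polarization: the symmetrization of a multilinear map is a linear combination of its values on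
the diagonal, namely of the values at the partial sums `∑ i ∈ s, m i` with signs depending
on the size of `s`. -/
theorem sum_perm_mem_span_diagonal {R M N : Type*} [CommRing R] [AddCommGroup M] [Module R M]
    [AddCommGroup N] [Module R N] {d : ℕ} (f : MultilinearMap R (fun _ : Fin d => M) N)
    (m : Fin d → M) :
    ∑ σ : Equiv.Perm (Fin d), f (m ∘ σ) ∈ Submodule.span R (Set.range fun x => f fun _ => x) := by
  classical
  have key : ∑ s : Finset (Fin d), (-1 : ℤ) ^ s.card • f (fun _ => ∑ i ∈ s, m i) =
      (-1 : ℤ) ^ d • ∑ σ : Equiv.Perm (Fin d), f (m ∘ σ) := by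
    have h1 : ∀ s : Finset (Fin d), f (fun _ => ∑ i ∈ s, m i) =
        ∑ r : Fin d → Fin d, if ∀ j, r j ∈ s then f (m ∘ r) else 0 := by
      intro s
      rw [MultilinearMap.map_sum_finset f (fun _ i => m i) (fun _ => s), ← Finset.sum_filter]
      refine Finset.sum_congr ?_ fun _ _ => rfl
      ext r
      simp
    have h2 : ∀ r : Fin d → Fin d,
        ∑ s : Finset (Fin d), (-1 : ℤ) ^ s.card • (if ∀ j, r j ∈ s then f (m ∘ r) else 0) =
          if Function.Bijective r then (-1 : ℤ) ^ d • f (m ∘ r) else 0 := by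
      intro r
      split_ifs with hr
      · rw [Finset.sum_eq_single Finset.univ]
        · simp
        · intro s _ hs
          obtain ⟨i, hi⟩ : ∃ i, i ∉ s := by
            by_contra! h
            exact hs (Finset.eq_univ_iff_forall.2 h)
          obtain ⟨j, rfl⟩ := hr.2 i
          rw [if_neg fun h => hi (h j), smul_zero]
        · simp
      · obtain ⟨i, hi⟩ : ∃ i, ∀ j, r j ≠ i := by
          by_contra! h
          exact hr (Finite.injective_iff_bijective.1 (Finite.injective_iff_surjective.2 h))
        -- toggling a point `i` outside the range of `r` cancels the summands in pairs
        refine Finset.sum_involution (fun s _ => if i ∈ s then s.erase i else insert i s)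
          ?_ ?_ (fun _ _ => Finset.mem_univ _) ?_
        · intro s _
          by_cases his : i ∈ s
          · have : (∀ j, r j ∈ s.erase i) ↔ ∀ j, r j ∈ s := by simp [hi]
            simp only [his, if_true, this]
            rw [← Finset.card_erase_add_one his, pow_succ]
            split_ifs <;> simp
          · have : (∀ j, r j ∈ insert i s) ↔ ∀ j, r j ∈ s := by simp [hi]
            simp only [his, if_false, this, Finset.card_insert_of_notMem his, pow_succ]
            split_ifs <;> simp
        · intro s _ _ h
          by_cases his : i ∈ s
          · rw [if_pos his] at h
            rw [← h] at his
            simp at his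
          · rw [if_neg his] at h
            exact his (h ▸ Finset.mem_insert_self i s)
        · intro s _
          by_cases his : i ∈ s <;> simp [his]
    simp only [h1, Finset.smul_sum]
    rw [Finset.sum_comm]
    simp only [h2]
    rw [← Finset.sum_filter]
    symm
    refine Finset.sum_bij (fun σ _ => (σ : Fin d → Fin d)) ?_ ?_ ?_ ?_
    · intro σ _
      exact Finset.mem_filter.2 ⟨Finset.mem_univ _, σ.bijective⟩
    · intro σ _ τ _ h
      exact DFunLike.coe_injective h
    · intro r hr
      exact ⟨Equiv.ofBijective r (Finset.mem_filter.1 hr).2, Finset.mem_univ _, rfl⟩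
    · intro σ _
      rfl
  have h3 : (-1 : ℤ) ^ d • ∑ s : Finset (Fin d), (-1 : ℤ) ^ s.card • f (fun _ => ∑ i ∈ s, m i) =
      ∑ σ : Equiv.Perm (Fin d), f (m ∘ σ) := by
    rw [key, smul_smul, ← mul_pow]
    simp
  rw [← h3]
  exact zsmul_mem (sum_mem fun s _ => zsmul_mem (Submodule.subset_span (Set.mem_range_self _)) _) _

/-! ### Complete reducibility of tensor powers -/

section Schur

variable {K : Type u} [Field K] {V : Type v} [AddCommGroup V] [Module K V]

/-- The endomorphism `g ⊗ ⋯ ⊗ g` of `V^{⊗d}`. -/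
noncomputable def tpow (d : ℕ) (g : V →ₗ[K] V) : (⨂[K]^d V) →ₗ[K] ⨂[K]^d V :=
  PiTensorProduct.map fun _ => g

@[simp]
theorem tpow_tprod (d : ℕ) (g : V →ₗ[K] V) (v : Fin d → V) :
    tpow d g (PiTensorProduct.tprod K v) = PiTensorProduct.tprod K fun j => g (v j) :=
  PiTensorProduct.map_tprod _ _

theorem mem_span_range_map [Module.Finite K V] (d : ℕ) (a : (⨂[K]^d V) →ₗ[K] ⨂[K]^d V) :
    a ∈ Submodule.span K
      (Set.range fun f : Fin d → V →ₗ[K] V => (PiTensorProduct.map f : (⨂[K]^d V) →ₗ[K] _)) := by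
  classical
  let b := Module.finBasis K V
  let B : Module.Basis _ K (⨂[K]^d V) := Basis.piTensorProduct fun _ : Fin d => b
  have h : a = ∑ p, ∑ q, B.repr (a (B p)) q •
      (PiTensorProduct.map fun i => (b.coord (p i)).smulRight (b (q i)) :
        (⨂[K]^d V) →ₗ[K] ⨂[K]^d V) := by
    refine B.ext fun r => ?_
    have h1 : ∀ p q, (PiTensorProduct.map fun i => (b.coord (p i)).smulRight (b (q i)) :
        (⨂[K]^d V) →ₗ[K] ⨂[K]^d V) (B r) = if p = r then B q else 0 := by
      intro p q
      rw [show B r = _ from Basis.piTensorProduct_apply _ r,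
        show B q = _ from Basis.piTensorProduct_apply _ q, PiTensorProduct.map_tprod]
      simp only [LinearMap.smulRight_apply]
      rw [MultilinearMap.map_smul_univ]
      simp [Finsupp.single_apply, Fintype.prod_ite_zero, ← funext_iff, eq_comm]
    simp only [LinearMap.sum_apply, LinearMap.smul_apply, h1]
    conv_lhs => rw [← B.sum_repr (a (B r))]
    simp
  rw [h]
  exact sum_mem fun p _ => sum_mem fun q _ =>
    Submodule.smul_mem _ _ (Submodule.subset_span (Set.mem_range_self _))

/-- The endomorphism of `V^{⊗d}` that permutes the tensor factors. -/
noncomputable def permTensor (K : Type u) [Field K] (V : Type v) [AddCommGroup V] [Module K V]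
    (d : ℕ) : Representation K (Equiv.Perm (Fin d)) (⨂[K]^d V) where
  toFun σ := (PiTensorProduct.reindex K (fun _ => V) σ).toLinearMap
  map_one' := by
    ext v
    simp
    rfl
  map_mul' σ τ := by
    ext v
    simp
    rfl

theorem permTensor_tprod (d : ℕ) (σ : Equiv.Perm (Fin d)) (v : Fin d → V) :
    permTensor K V d σ (PiTensorProduct.tprod K v) = PiTensorProduct.tprod K fun j => v (σ⁻¹ j) :=
  PiTensorProduct.reindex_tprod _ _

/-- Schur–Weyl duality: the endomorphisms of `V^{⊗d}` that commute with the permutations of the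
factors are spanned by the `g ⊗ ⋯ ⊗ g`. They are averages over all permutations, and averages of
`g₁ ⊗ ⋯ ⊗ g_d` are in this span by polarization. -/
theorem mem_span_range_tpow [CharZero K] [Module.Finite K V] (d : ℕ)
    (a : (⨂[K]^d V) →ₗ[K] ⨂[K]^d V)
    (ha : ∀ σ, a ∘ₗ permTensor K V d σ = permTensor K V d σ ∘ₗ a) :
    a ∈ Submodule.span K (Set.range (tpow (K := K) (V := V) d)) := by
  let P : ((⨂[K]^d V) →ₗ[K] ⨂[K]^d V) →ₗ[K] ((⨂[K]^d V) →ₗ[K] ⨂[K]^d V) :=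
    ∑ σ : Equiv.Perm (Fin d),
      LinearMap.llcomp K _ _ _ (permTensor K V d σ) ∘ₗ LinearMap.lcomp K _ (permTensor K V d σ⁻¹)
  have hP : ∀ c, P c = ∑ σ : Equiv.Perm (Fin d),
      permTensor K V d σ ∘ₗ c ∘ₗ permTensor K V d σ⁻¹ := by
    intro c
    simp only [P, LinearMap.sum_apply]
    rfl
  have h1 : P a = (d.factorial : K) • a := by
    rw [hP]
    have : ∀ σ : Equiv.Perm (Fin d), permTensor K V d σ ∘ₗ a ∘ₗ permTensor K V d σ⁻¹ = a := by
      intro σ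
      rw [← LinearMap.comp_assoc, ← ha, LinearMap.comp_assoc, ← Module.End.mul_eq_comp,
        ← Module.End.mul_eq_comp, ← map_mul, mul_inv_cancel, map_one, mul_one]
    simp [this, Fintype.card_perm, Nat.cast_smul_eq_nsmul]
  have h2 : ∀ c, P c ∈ Submodule.span K (Set.range (tpow (K := K) (V := V) d)) := by
    intro c
    have hc := mem_span_range_map d c
    induction hc using Submodule.span_induction with
    | zero => simp
    | add x y _ _ hx hy => rw [map_add]; exact add_mem hx hy
    | smul r x _ hx => rw [map_smul]; exact Submodule.smul_mem _ _ hx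
    | mem x hx =>
      obtain ⟨f, rfl⟩ := hx
      have hm := sum_perm_mem_span_diagonal
        (PiTensorProduct.mapMultilinear K (fun _ : Fin d => V) (fun _ : Fin d => V)) f
      rw [hP]
      refine (congrArg (· ∈ Submodule.span K (Set.range (tpow (K := K) (V := V) d))) ?_).mpr hm
      rw [← Equiv.sum_comp (Equiv.inv (Equiv.Perm (Fin d)))]
      refine Finset.sum_congr rfl fun σ _ => ?_
      ext v
      simp only [LinearMap.compMultilinearMap_apply, LinearMap.comp_apply, Equiv.inv_apply,
        permTensor_tprod, PiTensorProduct.map_tprod, PiTensorProduct.mapMultilinear_apply,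
        Function.comp_apply, inv_inv]
      refine congrArg _ (funext fun j => ?_)
      exact congrArg (fun k => f (σ j) (v k)) (σ.symm_apply_apply j)
  have h3 : a = (d.factorial : K)⁻¹ • P a := by
    rw [h1, smul_smul, inv_mul_cancel₀, one_smul]
    exact_mod_cast d.factorial_ne_zero
  rw [h3]
  exact Submodule.smul_mem _ _ (h2 a)


theorem tpow_comm_permTensor (d : ℕ) (g : V →ₗ[K] V) (σ : Equiv.Perm (Fin d)) :
    tpow d g ∘ₗ permTensor K V d σ = permTensor K V d σ ∘ₗ tpow d g := by
  ext v
  simp [permTensor_tprod]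

/-- The Schur algebra: the algebra of the endomorphisms of `V^{⊗d}` that commute with the
permutations of the tensor factors. -/
noncomputable abbrev schurAlgebra (K : Type u) [Field K] (V : Type v) [AddCommGroup V] [Module K V]
    (d : ℕ) : Subalgebra K (Module.End K (⨂[K]^d V)) :=
  Subalgebra.centralizer K (Set.range (permTensor K V d))

theorem mem_schurAlgebra {d : ℕ} {a : Module.End K (⨂[K]^d V)} :
    a ∈ schurAlgebra K V d ↔ ∀ σ, a ∘ₗ permTensor K V d σ = permTensor K V d σ ∘ₗ a := by
  rw [Subalgebra.mem_centralizer_iff, Set.forall_mem_range]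
  exact forall_congr' fun σ => eq_comm

/-- The Schur algebra is the endomorphism ring of a finitely generated module over the group algebra
of the symmetric group, which is semisimple by Maschke's theorem. -/
theorem isSemisimpleRing_schurAlgebra [CharZero K] [Module.Finite K V] (d : ℕ) :
    IsSemisimpleRing (schurAlgebra K V d) := by
  let R := MonoidAlgebra K (Equiv.Perm (Fin d))
  let W := (permTensor K V d).asModule
  have : IsSemisimpleModule R W := inferInstance
  have : Module.Finite R W := Module.Finite.of_restrictScalars_finite K R W
  have : IsSemisimpleRing (Module.End R W) := IsSemisimpleRing.moduleEnd R W
  let e : schurAlgebra K V d ≃+* Representation.IntertwiningMap (permTensor K V d)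
      (permTensor K V d) :=
    { toFun := fun a => ⟨a.1, mem_schurAlgebra.1 a.2⟩
      invFun := fun b => ⟨b.toLinearMap, mem_schurAlgebra.2 b.isIntertwining'⟩
      left_inv := fun _ => rfl
      right_inv := fun _ => rfl
      map_mul' := fun _ _ => rfl
      map_add' := fun _ _ => rfl }
  exact RingEquiv.isSemisimpleRing (R := Module.End R W) (e.trans
    (Representation.IntertwiningMap.equivAlgEnd (permTensor K V d)).toRingEquiv).symm

/-- Let `W` be a module over a semisimple algebra `A` of endomorphisms that is spanned by a set `S`.
Then a subspace of a sum of copies of `W` that is stable under `S` is the kernel of a projection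
commuting with `S`. -/
theorem exists_projection_comm {W : Type*} [AddCommGroup W] [Module K W]
    (A : Subalgebra K (Module.End K W)) [IsSemisimpleRing A] (S : Set (Module.End K W))
    (hSA : S ⊆ A) (hAS : ∀ a ∈ A, a ∈ Submodule.span K S) (X : Type*) (N : Submodule K (X →₀ W))
    (hN : ∀ g ∈ S, ∀ m ∈ N, Finsupp.mapRange.linearMap g m ∈ N) :
    ∃ e : (X →₀ W) →ₗ[K] (X →₀ W), (∀ m, m - e m ∈ N) ∧ (∀ m ∈ N, e m = 0) ∧
      ∀ g ∈ S, ∀ m, e (Finsupp.mapRange.linearMap g m) = Finsupp.mapRange.linearMap g (e m) := by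
  have hN' : ∀ a ∈ Submodule.span K S, ∀ m ∈ N, Finsupp.mapRange.linearMap a m ∈ N := by
    intro a ha m hm
    induction ha using Submodule.span_induction with
    | mem x hx => exact hN x hx m hm
    | zero =>
      convert N.zero_mem
      ext
      simp
    | add a b _ _ ha hb =>
      convert N.add_mem ha hb
      ext
      simp
    | smul c a _ ha =>
      convert N.smul_mem c ha
      ext
      simp
  let N' : Submodule A (X →₀ W) :=
    { carrier := N
      add_mem' := N.add_mem
      zero_mem' := N.zero_mem
      smul_mem' := by
        intro a m hm
        have h : a • m = Finsupp.mapRange.linearMap a.1 m := by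
          ext x
          rfl
        rw [h]
        exact hN' a.1 (hAS a.1 a.2) m hm }
  obtain ⟨C, hC⟩ := exists_isCompl N'
  refine ⟨(C.projection N' hC.symm).restrictScalars K, fun m => ?_, fun m hm => ?_,
    fun g hg m => ?_⟩
  · have h := Submodule.projection_add_projection_eq_self hC m
    have h' : m - C.projection N' hC.symm m = N'.projection C hC m := by
      rw [sub_eq_iff_eq_add, h]
    change m - C.projection N' hC.symm m ∈ N'
    rw [h']
    exact Submodule.projection_apply_mem _ _
  · exact (Submodule.projection_apply_eq_zero_iff hC.symm).2 hm
  · let a : A := ⟨g, hSA hg⟩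
    have h : ∀ m : X →₀ W, Finsupp.mapRange.linearMap g m = a • m := by
      intro m
      ext x
      rfl
    rw [h, h]
    exact map_smul (C.projection N' hC.symm) a m

/-- Let `Φ : S → F` be a linear map commuting with the actions of all endomorphisms of `V` on
`S` and `F`. An element `s` in the sum of the images of some natural maps `φ x : V^{⊗d} → S` whose
image `Φ s` is fixed by a set `H` of endomorphisms can be replaced by an element with the same
image that is itself fixed by `H`: on the direct sum of the copies of `V^{⊗d}`, the kernel of
the map to `F` has a complement stable under the Schur algebra. -/
theorem exists_invariant_lift [CharZero K] [Module.Finite K V] (d : ℕ)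
    {S F : Type*} [AddCommGroup S] [Module K S] [AddCommGroup F] [Module K F]
    (aS : (V →ₗ[K] V) → S →ₗ[K] S) (aF : (V →ₗ[K] V) → F →ₗ[K] F) (Φ : S →ₗ[K] F)
    (hΦ : ∀ g s, Φ (aS g s) = aF g (Φ s)) {X : Type*} (φ : X → (⨂[K]^d V) →ₗ[K] S)
    (hφ : ∀ x g w, φ x (tpow d g w) = aS g (φ x w)) (H : Set (V →ₗ[K] V)) (s : S)
    (hs : s ∈ ⨆ x, LinearMap.range (φ x)) (hH : ∀ h ∈ H, aF h (Φ s) = Φ s) :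
    ∃ s' ∈ ⨆ x, LinearMap.range (φ x), (∀ h ∈ H, aS h s' = s') ∧ Φ s' = Φ s := by
  have := isSemisimpleRing_schurAlgebra (K := K) (V := V) d
  let Ψ : (X →₀ ⨂[K]^d V) →ₗ[K] S := Finsupp.lsum K φ
  have hΨ : ∀ g m, Ψ (Finsupp.mapRange.linearMap (tpow d g) m) = aS g (Ψ m) := by
    intro g m
    induction m using Finsupp.induction_linear with
    | zero => simp
    | add a b ha hb => rw [map_add, map_add, ha, hb, map_add, map_add]
    | single x w => simp [Ψ, hφ]
  have hrange : LinearMap.range Ψ = ⨆ x, LinearMap.range (φ x) := by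
    refine le_antisymm ?_ (iSup_le fun x => ?_)
    · rintro _ ⟨m, rfl⟩
      exact sum_mem fun x _ => Submodule.mem_iSup_of_mem x ⟨m x, rfl⟩
    · rintro _ ⟨w, rfl⟩
      exact ⟨Finsupp.single x w, by simp [Ψ]⟩
  obtain ⟨e, he1, he2, he3⟩ := exists_projection_comm (schurAlgebra K V d)
    (Set.range (tpow d))
    (by
      rintro _ ⟨g, rfl⟩
      exact mem_schurAlgebra.2 (tpow_comm_permTensor d g))
    (fun a ha => mem_span_range_tpow d a (mem_schurAlgebra.1 ha)) X (LinearMap.ker (Φ ∘ₗ Ψ))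
    (by
      rintro _ ⟨g, rfl⟩ m hm
      rw [LinearMap.mem_ker, LinearMap.comp_apply] at hm ⊢
      rw [hΨ, hΦ, hm, map_zero])
  rw [← hrange] at hs ⊢
  obtain ⟨m, rfl⟩ := hs
  refine ⟨Ψ (e m), ⟨e m, rfl⟩, fun h hh => ?_, ?_⟩
  · rw [← hΨ, ← he3 _ ⟨h, rfl⟩]
    congr 1
    rw [← sub_eq_zero, ← map_sub]
    refine he2 _ ?_
    rw [LinearMap.mem_ker, LinearMap.comp_apply, map_sub, map_sub, hΨ, hΦ, hH h hh, sub_self]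
  · have := he1 m
    rw [LinearMap.mem_ker, LinearMap.comp_apply, map_sub, map_sub, sub_eq_zero] at this
    exact this.symm

end Schur

/-! ### The grading of the symmetric algebra -/

theorem pow_le_of_prod_ofFn_mem {K A : Type*} [Field K] [Ring A] [Algebra K A] (M N : Submodule K A)
    (n : ℕ) (h : ∀ m : Fin n → A, (∀ i, m i ∈ M) → (List.ofFn m).prod ∈ N) : M ^ n ≤ N := by
  rw [Submodule.pow_eq_span_pow_set, Submodule.span_le]
  intro a ha
  obtain ⟨f, rfl⟩ := Set.mem_pow.1 ha
  exact h _ fun i => (f i).2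

theorem prod_ofFn_mem_pow {K A : Type*} [Field K] [Ring A] [Algebra K A] {M : Submodule K A}
    {n : ℕ} {m : Fin n → A} (h : ∀ i, m i ∈ M) : (List.ofFn m).prod ∈ M ^ n := by
  rw [Submodule.pow_eq_span_pow_set]
  exact Submodule.subset_span (Set.mem_pow.2 ⟨fun i => ⟨m i, h i⟩, rfl⟩)

section SymGrading

variable {K : Type u} [Field K] {W : Type v} [AddCommGroup W] [Module K W]

/-- The degree `n` component of the symmetric algebra. -/
noncomputable def symDeg (K : Type u) [Field K] (W : Type v) [AddCommGroup W] [Module K W] (n : ℕ) :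
    Submodule K (SymmetricAlgebra K W) :=
  LinearMap.range (SymmetricAlgebra.ι K W) ^ n

theorem prod_mem_symDeg (n : ℕ) (w : Fin n → W) :
    ∏ j, SymmetricAlgebra.ι K W (w j) ∈ symDeg K W n := by
  rw [← List.prod_ofFn]
  exact prod_ofFn_mem_pow fun i => ⟨w i, rfl⟩

theorem symDeg_le {n : ℕ} {N : Submodule K (SymmetricAlgebra K W)}
    (h : ∀ w : Fin n → W, ∏ j, SymmetricAlgebra.ι K W (w j) ∈ N) : symDeg K W n ≤ N := by
  refine pow_le_of_prod_ofFn_mem _ _ _ fun m hm => ?_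
  choose w hw using hm
  obtain rfl : (fun j => SymmetricAlgebra.ι K W (w j)) = m := funext hw
  rw [List.prod_ofFn]
  exact h w

theorem mul_mem_symDeg {m n : ℕ} {a b : SymmetricAlgebra K W} (ha : a ∈ symDeg K W m)
    (hb : b ∈ symDeg K W n) : a * b ∈ symDeg K W (m + n) := by
  rw [symDeg, pow_add]
  exact Submodule.mul_mem_mul ha hb

/-- The component of degree `n`, read off from the algebra homomorphism `S(W) → S(W)[X]` with
`w ↦ wX`. -/
noncomputable def symProj (K : Type u) [Field K] (W : Type v) [AddCommGroup W] [Module K W]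
    (n : ℕ) : SymmetricAlgebra K W →ₗ[K] SymmetricAlgebra K W :=
  ((Polynomial.lcoeff (SymmetricAlgebra K W) n).restrictScalars K) ∘ₗ
    (SymmetricAlgebra.lift (((Polynomial.monomial 1).restrictScalars K) ∘ₗ
      SymmetricAlgebra.ι K W)).toLinearMap

theorem symProj_of_mem {m : ℕ} (n : ℕ) {a : SymmetricAlgebra K W} (ha : a ∈ symDeg K W m) :
    symProj K W n a = if m = n then a else 0 := by
  have h : symDeg K W m ≤ LinearMap.eqLocus
      (SymmetricAlgebra.lift (((Polynomial.monomial 1).restrictScalars K) ∘ₗ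
        SymmetricAlgebra.ι K W)).toLinearMap ((Polynomial.monomial m).restrictScalars K) := by
    refine symDeg_le fun w => ?_
    rw [LinearMap.mem_eqLocus]
    simp only [AlgHom.toLinearMap_apply, map_prod, SymmetricAlgebra.lift_ι_apply,
      LinearMap.comp_apply, LinearMap.restrictScalars_apply,
      ← Polynomial.C_mul_X_pow_eq_monomial, pow_one]
    rw [Finset.prod_mul_distrib]
    simp
  have h' := h ha
  rw [LinearMap.mem_eqLocus] at h'
  rw [symProj, LinearMap.comp_apply, h']
  simp [Polynomial.coeff_monomial]

/-- The elements of degree less than `n` in the symmetric algebra. -/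
noncomputable def symLT (K : Type u) [Field K] (W : Type v) [AddCommGroup W] [Module K W] (n : ℕ) :
    Submodule K (SymmetricAlgebra K W) :=
  ⨆ j : Fin n, symDeg K W j

theorem symDeg_le_symLT {m n : ℕ} (h : m < n) : symDeg K W m ≤ symLT K W n :=
  le_iSup (fun j : Fin n => symDeg K W j) ⟨m, h⟩

theorem symLT_mono {m n : ℕ} (h : m ≤ n) : symLT K W m ≤ symLT K W n :=
  iSup_le fun j => symDeg_le_symLT (j.2.trans_le h)

theorem sum_symProj_of_mem_symLT {n : ℕ} {a : SymmetricAlgebra K W} (ha : a ∈ symLT K W n) :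
    ∑ j ∈ Finset.range n, symProj K W j a = a := by
  have h : symLT K W n ≤ LinearMap.eqLocus (∑ j ∈ Finset.range n, symProj K W j) LinearMap.id := by
    refine iSup_le fun i b hb => ?_
    rw [LinearMap.mem_eqLocus, LinearMap.sum_apply]
    simp [symProj_of_mem _ hb]
  simpa using h ha

theorem exists_mem_symLT (a : SymmetricAlgebra K W) : ∃ n, a ∈ symLT K W n := by
  induction a using SymmetricAlgebra.induction with
  | algebraMap r =>
    refine ⟨1, symDeg_le_symLT Nat.zero_lt_one ?_⟩
    rw [symDeg, pow_zero]
    exact Submodule.algebraMap_mem r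
  | ι x =>
    refine ⟨2, symDeg_le_symLT Nat.one_lt_two ?_⟩
    rw [symDeg, pow_one]
    exact ⟨x, rfl⟩
  | mul a b ha hb =>
    obtain ⟨m, hm⟩ := ha
    obtain ⟨n, hn⟩ := hb
    refine ⟨m + n, ?_⟩
    have h : symLT K W m * symLT K W n ≤ symLT K W (m + n) := by
      simp only [symLT, Submodule.iSup_mul, Submodule.mul_iSup]
      refine iSup_le fun i => iSup_le fun j => Submodule.mul_le.2 fun a ha b hb => ?_
      exact symDeg_le_symLT (by omega) (mul_mem_symDeg ha hb)
    exact h (Submodule.mul_mem_mul hm hn)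
  | add a b ha hb =>
    obtain ⟨m, hm⟩ := ha
    obtain ⟨n, hn⟩ := hb
    exact ⟨max m n, add_mem (symLT_mono (le_max_left _ _) hm) (symLT_mono (le_max_right _ _) hn)⟩

theorem symMap_mem_symDeg (g : W →ₗ[K] W) {n : ℕ} {a : SymmetricAlgebra K W}
    (ha : a ∈ symDeg K W n) : symMap g a ∈ symDeg K W n := by
  have h : symDeg K W n ≤ (symDeg K W n).comap (symMap g).toLinearMap := by
    refine symDeg_le fun w => ?_
    rw [Submodule.mem_comap, AlgHom.toLinearMap_apply, map_prod]
    simp only [symMap, SymmetricAlgebra.lift_ι_apply, LinearMap.comp_apply]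
    exact prod_mem_symDeg n _
  exact h ha

theorem symProj_symMap (g : W →ₗ[K] W) (n : ℕ) (a : SymmetricAlgebra K W) :
    symProj K W n (symMap g a) = symMap g (symProj K W n a) := by
  obtain ⟨N, hN⟩ := exists_mem_symLT a
  have h : symLT K W N ≤ LinearMap.eqLocus (symProj K W n ∘ₗ (symMap g).toLinearMap)
      ((symMap g).toLinearMap ∘ₗ symProj K W n) := by
    refine iSup_le fun i b hb => ?_
    rw [LinearMap.mem_eqLocus]
    simp only [LinearMap.comp_apply, AlgHom.toLinearMap_apply, symProj_of_mem n hb,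
      symProj_of_mem n (symMap_mem_symDeg g hb)]
    split_ifs <;> simp
  exact h hN

end SymGrading

/-! ### Natural maps from tensor powers to the symmetric algebra -/

section NaturalMaps

variable {K : Type u} [Field K] {V : Type v} [AddCommGroup V] [Module K V]

/-- The linear maps `V^{⊗d} → S(V^{[≤p]})` with values in degree `n` that commute with all
endomorphisms of `V`. -/
def NatMap (K : Type u) [Field K] (V : Type v) [AddCommGroup V] [Module K V] (p d n : ℕ) :
    Set ((⨂[K]^d V) →ₗ[K] SAlg K V p) :=
  {φ | (∀ g w, φ (tpow d g w) = symMap (commSumMap p g) (φ w)) ∧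
    ∀ w, φ w ∈ symDeg K (CommSum K V p) n}

/-- The part of `S(V^{[≤p]})` of degree `n` that consists of values of natural maps
on `V^{⊗d}`. -/
noncomputable def natDeg (K : Type u) [Field K] (V : Type v) [AddCommGroup V] [Module K V]
    (p d n : ℕ) : Submodule K (SAlg K V p) :=
  ⨆ φ : NatMap K V p d n, LinearMap.range φ.1

theorem mem_natDeg {p d n : ℕ} {φ : (⨂[K]^d V) →ₗ[K] SAlg K V p} (hφ : φ ∈ NatMap K V p d n)
    (w : ⨂[K]^d V) : φ w ∈ natDeg K V p d n :=
  Submodule.mem_iSup_of_mem ⟨φ, hφ⟩ ⟨w, rfl⟩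

theorem tpow_mulEquiv {d e : ℕ} (g : V →ₗ[K] V) (t : (⨂[K]^d V) ⊗[K] (⨂[K]^e V)) :
    tpow (d + e) g (TensorPower.mulEquiv t) =
      TensorPower.mulEquiv (TensorProduct.map (tpow d g) (tpow e g) t) := by
  have hmul : ∀ (a : Fin d → V) (b : Fin e → V), TensorPower.mulEquiv
      (PiTensorProduct.tprod K a ⊗ₜ[K] PiTensorProduct.tprod K b) =
        PiTensorProduct.tprod K (Fin.append a b) := TensorPower.tprod_mul_tprod K
  have h : tpow (d + e) g ∘ₗ TensorPower.mulEquiv.toLinearMap =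
      TensorPower.mulEquiv.toLinearMap ∘ₗ TensorProduct.map (tpow d g) (tpow e g) := by
    refine TensorProduct.ext ?_
    ext a b
    change tpow (d + e) g (TensorPower.mulEquiv
        (PiTensorProduct.tprod K a ⊗ₜ[K] PiTensorProduct.tprod K b)) =
      TensorPower.mulEquiv (tpow d g (PiTensorProduct.tprod K a) ⊗ₜ[K]
        tpow e g (PiTensorProduct.tprod K b))
    rw [hmul, tpow_tprod, tpow_tprod, tpow_tprod, hmul]
    congr 1
    funext j
    refine Fin.addCases (fun i => ?_) (fun i => ?_) j <;> simp
  exact congrArg (fun f => f t) h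

theorem natDeg_mul_le (p d e m n : ℕ) :
    natDeg K V p d m * natDeg K V p e n ≤ natDeg K V p (d + e) (m + n) := by
  rw [natDeg, natDeg]
  simp only [Submodule.iSup_mul, Submodule.mul_iSup]
  refine iSup_le fun ⟨ψ, hψ⟩ => iSup_le fun ⟨φ, hφ⟩ => Submodule.mul_le.2 ?_
  rintro _ ⟨a, rfl⟩ _ ⟨b, rfl⟩
  let θ : (⨂[K]^d V) ⊗[K] (⨂[K]^e V) →ₗ[K] SAlg K V p :=
    LinearMap.mul' K _ ∘ₗ TensorProduct.map φ ψ
  have h1 : ∀ g t, θ (TensorProduct.map (tpow d g) (tpow e g) t) =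
      symMap (commSumMap p g) (θ t) := by
    intro g t
    induction t using TensorProduct.induction_on with
    | zero => simp
    | tmul a b => simp [θ, hφ.1, hψ.1]
    | add a b ha hb => rw [map_add, map_add, ha, hb, map_add, map_add]
  have h2 : ∀ t, θ t ∈ symDeg K (CommSum K V p) (m + n) := by
    intro t
    induction t using TensorProduct.induction_on with
    | zero => simp
    | tmul a b =>
      simp only [θ, LinearMap.comp_apply, TensorProduct.map_tmul, LinearMap.mul'_apply]
      exact mul_mem_symDeg (hφ.2 a) (hψ.2 b)
    | add a b ha hb => rw [map_add]; exact add_mem ha hb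
  have h3 : θ ∘ₗ TensorPower.mulEquiv.symm.toLinearMap ∈ NatMap K V p (d + e) (m + n) := by
    refine ⟨fun g w => ?_, fun w => h2 _⟩
    obtain ⟨t, rfl⟩ := TensorPower.mulEquiv.surjective w
    simp only [LinearMap.comp_apply, LinearEquiv.coe_coe]
    rw [tpow_mulEquiv, LinearEquiv.symm_apply_apply, LinearEquiv.symm_apply_apply, h1]
  have h4 := mem_natDeg h3 (TensorPower.mulEquiv (a ⊗ₜ[K] b))
  simpa [θ] using h4

theorem one_mem_natDeg (p : ℕ) : (1 : SAlg K V p) ∈ natDeg K V p 0 0 := by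
  let φ : (⨂[K]^0 V) →ₗ[K] SAlg K V p :=
    Algebra.linearMap K _ ∘ₗ (PiTensorProduct.isEmptyEquiv (Fin 0)).toLinearMap
  have hφ : φ ∈ NatMap K V p 0 0 := by
    refine ⟨fun g w => ?_, fun w => ?_⟩
    · have h : φ ∘ₗ tpow 0 g = (symMap (commSumMap p g)).toLinearMap ∘ₗ φ := by
        ext v
        simp [φ]
      exact congrArg (fun f => f w) h
    · rw [symDeg, pow_zero]
      exact Submodule.algebraMap_mem _
  have h := mem_natDeg hφ (PiTensorProduct.tprod K fun _ => 0)
  simpa [φ] using h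

/-- The left-normed commutator of elements of `V` is a multilinear function with values in
`T(V)`. -/
theorem exists_multilinear_leftNormed (K : Type u) [Field K] (V : Type v) [AddCommGroup V]
    [Module K V] (n : ℕ) :
    ∃ f : MultilinearMap K (fun _ : Fin (n + 1) => V) (TensorAlgebra K V), ∀ v : ℕ → V,
      f (fun j => v j) = leftNormed (fun j => TensorAlgebra.ι K (v j)) n := by
  induction n with
  | zero =>
    refine ⟨(MultilinearMap.ofSubsingleton K V _ (0 : Fin 1)) (TensorAlgebra.ι K), fun v => ?_⟩
    simp [leftNormed]
  | succ n ih =>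
    obtain ⟨f, hf⟩ := ih
    let br : TensorAlgebra K V →ₗ[K] V →ₗ[K] TensorAlgebra K V :=
      (LinearMap.mul K (TensorAlgebra K V) - (LinearMap.mul K (TensorAlgebra K V)).flip).compl₂
        (TensorAlgebra.ι K)
    refine ⟨(br.compMultilinearMap f).uncurryRight, fun v => ?_⟩
    rw [MultilinearMap.uncurryRight_apply, LinearMap.compMultilinearMap_apply]
    have : Fin.init (fun j : Fin (n + 2) => v j) = fun j : Fin (n + 1) => v j := rfl
    rw [this, hf]
    simp [br, leftNormed]

theorem commSumMap_incl {p : ℕ} (g : V →ₗ[K] V) (i : Fin p) (x : commSpace K V i) :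
    commSumMap p g (incl p i x) =
      incl p i ⟨tensorMap g x.1, tensorMap_mem_commSpace g i x.1 x.2⟩ := by
  ext j
  by_cases h : j = i
  · subst h
    simp [commSumMap, incl]
  · simp [commSumMap, incl, h]

theorem ι_incl_mem_natDeg {p : ℕ} (i : Fin p) (x : commSpace K V i) :
    SymmetricAlgebra.ι K (CommSum K V p) (incl p i x) ∈ natDeg K V p (i + 1) 1 := by
  obtain ⟨f, hf⟩ := exists_multilinear_leftNormed K V i
  -- every tuple indexed by `Fin (i + 1)` is the beginning of a sequence
  have hext : ∀ v : Fin (i + 1) → V, ∃ v' : ℕ → V, v = fun j : Fin (i + 1) => v' j := fun v =>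
    ⟨fun j => if h : j < i + 1 then v ⟨j, h⟩ else 0, by
      funext j
      simp only [Fin.is_lt, dite_true]⟩
  have hmem : ∀ w, PiTensorProduct.lift f w ∈ commSpace K V i := by
    intro w
    have h : LinearMap.range (PiTensorProduct.lift f) ≤ commSpace K V i := by
      rw [LinearMap.range_eq_map, ← PiTensorProduct.span_tprod_eq_top, Submodule.map_span_le]
      rintro _ ⟨v, rfl⟩
      obtain ⟨v', rfl⟩ := hext v
      rw [PiTensorProduct.lift.tprod, hf]
      exact Submodule.subset_span ⟨v', rfl⟩
    exact h ⟨w, rfl⟩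
  have hnat : ∀ g w, PiTensorProduct.lift f (tpow (i + 1) g w) =
      tensorMap g (PiTensorProduct.lift f w) := by
    intro g w
    have h : PiTensorProduct.lift f ∘ₗ tpow (i + 1) g =
        (tensorMap g).toLinearMap ∘ₗ PiTensorProduct.lift f := by
      ext v
      obtain ⟨v', rfl⟩ := hext v
      simp only [LinearMap.compMultilinearMap_apply, LinearMap.comp_apply, tpow_tprod,
        PiTensorProduct.lift.tprod, AlgHom.toLinearMap_apply]
      rw [hf, hf fun j => g (v' j), map_leftNormed]
      simp [tensorMap]
    exact congrArg (fun f => f w) h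
  let φ : (⨂[K]^((i : ℕ) + 1) V) →ₗ[K] SAlg K V p :=
    SymmetricAlgebra.ι K (CommSum K V p) ∘ₗ incl p i ∘ₗ
      (PiTensorProduct.lift f).codRestrict (commSpace K V i) hmem
  have hφ : φ ∈ NatMap K V p (i + 1) 1 := by
    refine ⟨fun g w => ?_, fun w => ?_⟩
    · simp only [φ, LinearMap.comp_apply, symMap, SymmetricAlgebra.lift_ι_apply, commSumMap_incl]
      congr 2
      exact Subtype.ext (hnat g w)
    · rw [symDeg, pow_one]
      exact ⟨_, rfl⟩
  have hle : commSpace K V i ≤ LinearMap.range (PiTensorProduct.lift f) := by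
    refine Submodule.span_le.2 ?_
    rintro _ ⟨v, rfl⟩
    exact ⟨PiTensorProduct.tprod K fun j => v j, by rw [PiTensorProduct.lift.tprod, hf]⟩
  obtain ⟨w, hw⟩ := hle x.2
  have h := mem_natDeg hφ w
  have hx : (PiTensorProduct.lift f).codRestrict (commSpace K V i) hmem w = x := Subtype.ext hw
  simpa only [φ, LinearMap.comp_apply, hx] using h

/-- `S(V^{[≤p]})` is exhausted by the natural images of the tensor powers of `V`. -/
theorem symDeg_le_iSup_natDeg (p n : ℕ) :
    symDeg K (CommSum K V p) n ≤ ⨆ d, natDeg K V p d n := by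
  induction n with
  | zero =>
    rw [symDeg, pow_zero, Submodule.one_le]
    exact Submodule.mem_iSup_of_mem 0 (one_mem_natDeg p)
  | succ n ih =>
    have h1 : LinearMap.range (SymmetricAlgebra.ι K (CommSum K V p)) ≤ ⨆ d, natDeg K V p d 1 := by
      rintro _ ⟨w, rfl⟩
      have hw : w = ∑ i, incl p i (w i) := (LinearMap.sum_single_apply _ w).symm
      rw [hw, map_sum]
      exact sum_mem fun i _ => Submodule.mem_iSup_of_mem _ (ι_incl_mem_natDeg i (w i))
    rw [symDeg, pow_succ]
    refine (mul_le_mul' ih h1).trans ?_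
    simp only [Submodule.iSup_mul, Submodule.mul_iSup]
    exact iSup_le fun d => iSup_le fun e =>
      (natDeg_mul_le p _ _ n 1).trans (le_iSup (fun d => natDeg K V p d (n + 1)) _)

end NaturalMaps

/-! ### Products of elements of a Lie subalgebra -/

section Filtration

variable {K A : Type*} [Field K] [Ring A] [Algebra K A]

/-- The span of the products of fewer than `n` elements of `L`, with `1` as the empty product; thus
it is `0` for `n = 0`. -/
def lower (L : Submodule K A) : ℕ → Submodule K A
  | 0 => ⊥
  | n + 1 => (1 ⊔ L) ^ n

theorem sup_pow_mono (L : Submodule K A) : Monotone fun n => (1 ⊔ L) ^ n := by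
  refine monotone_nat_of_le_succ fun n => ?_
  calc (1 ⊔ L) ^ n = (1 ⊔ L) ^ n * 1 := (mul_one _).symm
    _ ≤ (1 ⊔ L) ^ n * (1 ⊔ L) := mul_le_mul' le_rfl le_sup_left
    _ = (1 ⊔ L) ^ (n + 1) := (pow_succ _ _).symm

theorem lower_le (L : Submodule K A) (n : ℕ) : lower L n ≤ (1 ⊔ L) ^ n := by
  cases n with
  | zero => exact bot_le
  | succ n => exact sup_pow_mono L n.le_succ

theorem mul_mem_lower_left {L : Submodule K A} {m n : ℕ} {a b : A} (ha : a ∈ (1 ⊔ L) ^ m)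
    (hb : b ∈ lower L n) : a * b ∈ lower L (m + n) := by
  cases n with
  | zero =>
    rw [show b = 0 from hb, mul_zero]
    exact zero_mem _
  | succ n =>
    change a * b ∈ (1 ⊔ L) ^ (m + n)
    rw [pow_add]
    exact Submodule.mul_mem_mul ha hb

theorem mul_mem_lower_right {L : Submodule K A} {m n : ℕ} {a b : A} (ha : a ∈ lower L m)
    (hb : b ∈ (1 ⊔ L) ^ n) : a * b ∈ lower L (m + n) := by
  cases m with
  | zero =>
    rw [show a = 0 from ha, zero_mul]
    exact zero_mem _
  | succ m =>
    rw [Nat.add_right_comm]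
    change a * b ∈ (1 ⊔ L) ^ (m + n)
    rw [pow_add]
    exact Submodule.mul_mem_mul ha hb

theorem list_prod_mem_sup_pow {L : Submodule K A} (l : List A) (h : ∀ a ∈ l, a ∈ L) :
    l.prod ∈ (1 ⊔ L) ^ l.length := by
  induction l with
  | nil =>
    rw [List.prod_nil, List.length_nil, pow_zero]
    exact Submodule.one_le.1 le_rfl
  | cons a l ih =>
    rw [List.prod_cons, List.length_cons, pow_succ']
    exact Submodule.mul_mem_mul (Submodule.mem_sup_right (h a List.mem_cons_self))
      (ih fun b hb => h b (List.mem_cons_of_mem a hb))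

/-- In a product of elements of a Lie subalgebra, the order of the factors does not matter up to
products of fewer factors. -/
theorem prod_sub_prod_mem_lower {L : Submodule K A} (hL : ∀ a ∈ L, ∀ b ∈ L, a * b - b * a ∈ L)
    {l l' : List A} (h : l.Perm l') (hl : ∀ a ∈ l, a ∈ L) :
    l.prod - l'.prod ∈ lower L l.length := by
  induction h with
  | nil => simp
  | cons a _ ih =>
    rw [List.prod_cons, List.prod_cons, ← mul_sub, List.length_cons, Nat.add_comm]
    refine mul_mem_lower_left ?_ (ih fun b hb => hl b (List.mem_cons_of_mem a hb))
    rw [pow_one]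
    exact Submodule.mem_sup_right (hl a List.mem_cons_self)
  | swap a b l =>
    have h1 : (b :: a :: l).prod - (a :: b :: l).prod = (b * a - a * b) * l.prod := by
      simp only [List.prod_cons]
      noncomm_ring
    rw [h1]
    change _ ∈ (1 ⊔ L) ^ (l.length + 1)
    rw [pow_succ']
    exact Submodule.mul_mem_mul (Submodule.mem_sup_right (hL b (hl b (by simp)) a (hl a (by simp))))
      (list_prod_mem_sup_pow l fun c hc => hl c (by simp [hc]))
  | trans h1 h2 ih1 ih2 =>
    have h3 := ih2 fun a ha => hl a (h1.mem_iff.2 ha)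
    rw [← h1.length_eq] at h3
    rw [← sub_add_sub_cancel]
    exact add_mem (ih1 hl) h3

/-- A product of elements of a Lie subalgebra agrees with its symmetrization up to products of fewer
factors. -/
theorem prod_sub_average_mem_lower [CharZero K] {L : Submodule K A}
    (hL : ∀ a ∈ L, ∀ b ∈ L, a * b - b * a ∈ L) {n : ℕ} {y : Fin n → A} (hy : ∀ j, y j ∈ L) :
    (List.ofFn y).prod - (n.factorial : K)⁻¹ •
      ∑ σ : Equiv.Perm (Fin n), (List.ofFn fun j => y (σ j)).prod ∈ lower L n := by
  have hn : (n.factorial : K) ≠ 0 := by exact_mod_cast n.factorial_ne_zero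
  have h : (List.ofFn y).prod = (n.factorial : K)⁻¹ •
      ∑ _σ : Equiv.Perm (Fin n), (List.ofFn y).prod := by
    rw [Finset.sum_const, Finset.card_univ, Fintype.card_perm, Fintype.card_fin,
      ← Nat.cast_smul_eq_nsmul K, smul_smul, inv_mul_cancel₀ hn, one_smul]
  rw [h, ← smul_sub, ← Finset.sum_sub_distrib]
  refine Submodule.smul_mem _ _ (sum_mem fun σ _ => ?_)
  have h' := prod_sub_prod_mem_lower hL (σ.ofFn_comp_perm y).symm fun a ha => by
    obtain ⟨j, rfl⟩ := List.mem_ofFn.1 ha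
    exact hy j
  rwa [List.length_ofFn] at h'

theorem sup_pow_le_iSup_pow (L : Submodule K A) (n : ℕ) :
    (1 ⊔ L) ^ n ≤ ⨆ j : Fin (n + 1), L ^ (j : ℕ) := by
  induction n with
  | zero =>
    rw [pow_zero]
    exact le_iSup_of_le 0 (by simp)
  | succ n ih =>
    rw [pow_succ]
    refine (mul_le_mul' ih le_rfl).trans ?_
    rw [Submodule.iSup_mul]
    refine iSup_le fun j => ?_
    rw [Submodule.mul_sup, mul_one, ← pow_succ]
    exact sup_le (le_iSup (fun j : Fin (n + 2) => L ^ (j : ℕ)) j.castSucc)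
      (le_iSup (fun j : Fin (n + 2) => L ^ (j : ℕ)) j.succ)

theorem mul_sub_eq_of_factors {A : Type*} [Ring A] (a b x y c : A) :
    a * b - c = x * y - c - (x - a) * y - a * (y - b) := by
  noncomm_ring

end Filtration

/-! ### Commutators of commutators -/

section Commutators

variable {K : Type u} [Field K] {V : Type v} [AddCommGroup V] [Module K V]

theorem leftNormed_congr {A : Type*} [Ring A] {a b : ℕ → A} {n : ℕ} (h : ∀ j ≤ n, a j = b j) :
    leftNormed a n = leftNormed b n := by
  induction n with
  | zero => exact h 0 le_rfl
  | succ n ih =>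
    simp only [leftNormed]
    rw [ih fun j hj => h j (hj.trans n.le_succ), h _ le_rfl]

theorem commSpace_bracket_ι {i : ℕ} {x : TensorAlgebra K V} (hx : x ∈ commSpace K V i) (v : V) :
    x * TensorAlgebra.ι K v - TensorAlgebra.ι K v * x ∈ commSpace K V (i + 1) := by
  have h : commSpace K V i ≤ (commSpace K V (i + 1)).comap
      (LinearMap.mulRight K (TensorAlgebra.ι K v) - LinearMap.mulLeft K (TensorAlgebra.ι K v)) := by
    refine Submodule.span_le.2 ?_
    rintro _ ⟨u, rfl⟩
    refine Submodule.subset_span ⟨Function.update u (i + 1) v, ?_⟩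
    simp only [leftNormed, Function.update_self, LinearMap.sub_apply, LinearMap.mulRight_apply,
      LinearMap.mulLeft_apply]
    rw [leftNormed_congr (b := fun j => TensorAlgebra.ι K (u j))]
    intro j hj
    rw [Function.update_of_ne (by omega)]
  exact h hx

/-- `[V^{[i]}, V^{[j]}] ⊆ V^{[i+j]}`, by the Jacobi identity (the lengths of the commutators are
`i + 1` and `j + 1` in the indexing of `commSpace`). -/
theorem commSpace_bracket {i j : ℕ} {x y : TensorAlgebra K V} (hx : x ∈ commSpace K V i)
    (hy : y ∈ commSpace K V j) : x * y - y * x ∈ commSpace K V (i + j + 1) := by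
  induction j generalizing i x y with
  | zero =>
    have h : commSpace K V 0 ≤ (commSpace K V (i + 0 + 1)).comap
        (LinearMap.mulLeft K x - LinearMap.mulRight K x) := by
      refine Submodule.span_le.2 ?_
      rintro _ ⟨u, rfl⟩
      exact commSpace_bracket_ι hx (u 0)
    exact h hy
  | succ j ih =>
    have h : commSpace K V (j + 1) ≤ (commSpace K V (i + (j + 1) + 1)).comap
        (LinearMap.mulLeft K x - LinearMap.mulRight K x) := by
      refine Submodule.span_le.2 ?_
      rintro _ ⟨u, rfl⟩
      have hb : leftNormed (fun k => TensorAlgebra.ι K (u k)) j ∈ commSpace K V j :=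
        Submodule.subset_span ⟨u, rfl⟩
      have h1 := commSpace_bracket_ι (ih hx hb) (u (j + 1))
      have h2 := ih (commSpace_bracket_ι hx (u (j + 1))) hb
      rw [show i + 1 + j + 1 = i + (j + 1) + 1 by omega] at h2
      have h3 := sub_mem h1 h2
      simp only [leftNormed, SetLike.mem_coe, Submodule.mem_comap, LinearMap.sub_apply,
        LinearMap.mulRight_apply, LinearMap.mulLeft_apply]
      refine (congrArg (· ∈ commSpace K V (i + (j + 1) + 1)) ?_).mpr h3
      noncomm_ring
    exact h hy

end Commutators

/-! ### Symmetrization with values in the relatively free algebra -/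

section RelativelyFree

variable {K : Type u} [Field K] (I : Set (FreeAlgebra K ℕ))
  {V : Type v} [AddCommGroup V] [Module K V]

theorem nu_surjective (V : Type v) [AddCommGroup V] [Module K V] :
    Function.Surjective (nu I V) :=
  RingQuot.mkAlgHom_surjective K _

theorem satisfies_relFree (V : Type v) [AddCommGroup V] [Module K V] :
    Satisfies I (RelFree I V) := by
  intro f hf a
  choose t ht using fun j => nu_surjective I V (a j)
  have h : FreeAlgebra.lift K a = (nu I V).comp (FreeAlgebra.lift K t) := by
    ext j
    simp [ht]
  rw [h]
  exact (RingQuot.mkAlgHom_rel K (IdRel.of f hf t)).trans (map_zero _)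

variable {I}

/-- The inclusion of varieties refers to algebras in the universe of `K`; it yields the identity in
every algebra `A` by mapping the relatively free algebra of countable rank to `A`. -/
theorem leftNormed_eq_zero {p : ℕ} (hI : VarietyLE I (lieNilpotent K p)) {A : Type*} [Ring A]
    [Algebra K A] (hA : Satisfies I A) (a : ℕ → A) : leftNormed a p = 0 := by
  let U : Type u := RelFree I (ℕ →₀ K)
  let x : ℕ → U := fun j => nu I (ℕ →₀ K) (TensorAlgebra.ι K (Finsupp.single j 1))
  have h := hI U (satisfies_relFree I (ℕ →₀ K)) _ rfl x
  rw [map_leftNormed] at h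
  simp only [FreeAlgebra.lift_ι_apply] at h
  let ψ : TensorAlgebra K (ℕ →₀ K) →ₐ[K] A :=
    TensorAlgebra.lift K (Finsupp.linearCombination K a)
  have hψ : ∀ ⦃s t⦄, IdRel I (ℕ →₀ K) s t → ψ s = ψ t := by
    rintro _ _ ⟨f, hf, t⟩
    have h1 : ψ.comp (FreeAlgebra.lift K t) = FreeAlgebra.lift K fun j => ψ (t j) := by
      ext j
      simp
    rw [map_zero, ← AlgHom.comp_apply, h1, hA f hf]
  let χ : RelFree I (ℕ →₀ K) →ₐ[K] A := RingQuot.liftAlgHom K ⟨ψ, hψ⟩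
  have h2 := congrArg χ h
  rw [map_leftNormed, map_zero] at h2
  rw [← h2]
  congr 1
  funext j
  simp only [χ, x, nu, RingQuot.liftAlgHom_mkAlgHom_apply]
  simp [ψ]

theorem nu_eq_zero_of_mem_commSpace {p : ℕ} (hI : VarietyLE I (lieNilpotent K p)) {i : ℕ}
    (hi : p ≤ i) {x : TensorAlgebra K V} (hx : x ∈ commSpace K V i) : nu I V x = 0 := by
  have h : commSpace K V i ≤ LinearMap.ker (nu I V).toLinearMap := by
    refine Submodule.span_le.2 ?_
    rintro _ ⟨u, rfl⟩
    simp only [SetLike.mem_coe, LinearMap.mem_ker, AlgHom.toLinearMap_apply]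
    rw [map_leftNormed]
    clear hx
    induction i, hi using Nat.le_induction with
    | base => exact leftNormed_eq_zero hI (satisfies_relFree I V) _
    | succ n _ ih =>
      rw [leftNormed, ih, zero_mul, mul_zero, sub_zero]
  exact h hx

variable (I V) in
/-- The image of `V^{[≤p]}` in the relatively free algebra. -/
noncomputable def lieImage (p : ℕ) : Submodule K (RelFree I V) :=
  LinearMap.range ((piF I V p).toLinearMap ∘ₗ TensorAlgebra.ι K)

theorem piF_ι {p : ℕ} (w : CommSum K V p) :
    piF I V p (TensorAlgebra.ι K w) = ∑ i, nu I V (w i) := by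
  simp [piF, piT]

theorem nu_mem_lieImage {p : ℕ} (hI : VarietyLE I (lieNilpotent K p)) {i : ℕ}
    {x : TensorAlgebra K V} (hx : x ∈ commSpace K V i) : nu I V x ∈ lieImage I V p := by
  by_cases hi : i < p
  · refine ⟨incl p ⟨i, hi⟩ ⟨x, hx⟩, ?_⟩
    rw [LinearMap.comp_apply, AlgHom.toLinearMap_apply, piF_ι, Finset.sum_eq_single ⟨i, hi⟩]
    · simp [incl]
    · intro j _ hj
      simp [incl, hj]
    · simp
  · rw [nu_eq_zero_of_mem_commSpace hI (not_lt.1 hi) hx]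
    exact zero_mem _

/-- The image of `V^{[≤p]}` is a Lie subalgebra: commutators that are too long to be in
`V^{[≤p]}` vanish in the relatively free algebra. -/
theorem lieImage_bracket {p : ℕ} (hI : VarietyLE I (lieNilpotent K p)) :
    ∀ a ∈ lieImage I V p, ∀ b ∈ lieImage I V p, a * b - b * a ∈ lieImage I V p := by
  rintro _ ⟨a, rfl⟩ _ ⟨b, rfl⟩
  simp only [LinearMap.comp_apply, AlgHom.toLinearMap_apply, piF_ι]
  rw [Finset.sum_mul_sum, Finset.sum_mul_sum, Finset.sum_comm (s := Finset.univ (α := Fin p)),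
    ← Finset.sum_sub_distrib]
  refine sum_mem fun i _ => ?_
  rw [← Finset.sum_sub_distrib]
  refine sum_mem fun j _ => ?_
  rw [← map_mul, ← map_mul, ← map_sub]
  exact nu_mem_lieImage hI (commSpace_bracket (a j).2 (b i).2)

theorem exists_mem_lower_lieImage {p : ℕ} (hI : VarietyLE I (lieNilpotent K p))
    (x : RelFree I V) : ∃ n, x ∈ lower (lieImage I V p) n := by
  suffices h : ∃ n, x ∈ (1 ⊔ lieImage I V p) ^ n from h.imp' Nat.succ fun _ h => h
  obtain ⟨t, rfl⟩ := nu_surjective I V x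
  induction t using TensorAlgebra.induction with
  | algebraMap r =>
    refine ⟨0, ?_⟩
    rw [AlgHom.commutes, pow_zero]
    exact Submodule.algebraMap_mem r
  | ι v =>
    refine ⟨1, ?_⟩
    rw [pow_one]
    refine Submodule.mem_sup_right (nu_mem_lieImage hI (i := 0) ?_)
    exact Submodule.subset_span ⟨fun _ => v, rfl⟩
  | mul a b ha hb =>
    obtain ⟨m, hm⟩ := ha
    obtain ⟨n, hn⟩ := hb
    refine ⟨m + n, ?_⟩
    rw [map_mul, pow_add]
    exact Submodule.mul_mem_mul hm hn
  | add a b ha hb =>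
    obtain ⟨m, hm⟩ := ha
    obtain ⟨n, hn⟩ := hb
    refine ⟨max m n, ?_⟩
    rw [map_add]
    exact add_mem (sup_pow_mono _ (le_max_left m n) hm) (sup_pow_mono _ (le_max_right m n) hn)

variable (I V) in
/-- The linear map `S(V^{[≤p]}) → F` that sends a product to the average of the products of the
factors in all orders. -/
noncomputable def symToRelFree (p : ℕ) : SAlg K V p →ₗ[K] RelFree I V :=
  (piF I V p).toLinearMap ∘ₗ symmetrization K (CommSum K V p)

theorem prod_sub_symToRelFree_mem_lower [CharZero K] {p : ℕ}
    (hI : VarietyLE I (lieNilpotent K p)) {n : ℕ} (w : Fin n → CommSum K V p) :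
    (List.ofFn fun j => piF I V p (TensorAlgebra.ι K (w j))).prod -
      symToRelFree I V p (∏ j, SymmetricAlgebra.ι K _ (w j)) ∈ lower (lieImage I V p) n := by
  have h1 : symToRelFree I V p (∏ j, SymmetricAlgebra.ι K _ (w j)) =
      (n.factorial : K)⁻¹ • ∑ σ : Equiv.Perm (Fin n),
        (List.ofFn fun j => piF I V p (TensorAlgebra.ι K (w (σ j)))).prod := by
    rw [symToRelFree, LinearMap.comp_apply, symmetrization_prod, map_smul, map_sum]
    congr 1
    refine Finset.sum_congr rfl fun σ _ => ?_
    rw [AlgHom.toLinearMap_apply, map_list_prod, List.map_ofFn]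
    rfl
  rw [h1]
  exact prod_sub_average_mem_lower (lieImage_bracket hI) fun j => ⟨w j, rfl⟩

theorem symToRelFree_mem_sup_pow [CharZero K] {p : ℕ} (hI : VarietyLE I (lieNilpotent K p))
    {n : ℕ} {a : SAlg K V p} (ha : a ∈ symDeg K (CommSum K V p) n) :
    symToRelFree I V p a ∈ (1 ⊔ lieImage I V p) ^ n := by
  have h : symDeg K (CommSum K V p) n ≤
      ((1 ⊔ lieImage I V p) ^ n).comap (symToRelFree I V p) := by
    refine symDeg_le fun w => ?_
    have h1 := lower_le _ _ (prod_sub_symToRelFree_mem_lower hI w)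
    have h2 := list_prod_mem_sup_pow (L := lieImage I V p)
      (List.ofFn fun j => piF I V p (TensorAlgebra.ι K (w j))) fun a ha => by
        obtain ⟨j, rfl⟩ := List.mem_ofFn.1 ha
        exact ⟨w j, rfl⟩
    rw [List.length_ofFn] at h2
    have h3 := sub_mem h2 h1
    rwa [sub_sub_cancel] at h3
  exact h ha

/-- Symmetrization is multiplicative up to products of fewer factors. -/
theorem symToRelFree_mul_sub_mem_lower [CharZero K] {p : ℕ} (hI : VarietyLE I (lieNilpotent K p))
    {m n : ℕ} {a b : SAlg K V p} (ha : a ∈ symDeg K (CommSum K V p) m)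
    (hb : b ∈ symDeg K (CommSum K V p) n) :
    symToRelFree I V p a * symToRelFree I V p b - symToRelFree I V p (a * b) ∈
      lower (lieImage I V p) (m + n) := by
  have key : ∀ (w : Fin m → CommSum K V p) (w' : Fin n → CommSum K V p),
      symToRelFree I V p (∏ j, SymmetricAlgebra.ι K _ (w j)) *
          symToRelFree I V p (∏ j, SymmetricAlgebra.ι K _ (w' j)) -
        symToRelFree I V p ((∏ j, SymmetricAlgebra.ι K _ (w j)) *
          ∏ j, SymmetricAlgebra.ι K _ (w' j)) ∈ lower (lieImage I V p) (m + n) := by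
    intro w w'
    have h1 := prod_sub_symToRelFree_mem_lower hI w
    have h2 := prod_sub_symToRelFree_mem_lower hI w'
    have h3 := prod_sub_symToRelFree_mem_lower hI (Fin.append w w')
    have hY : (List.ofFn fun j => piF I V p (TensorAlgebra.ι K (w' j))).prod ∈
        (1 ⊔ lieImage I V p) ^ n := by
      have h := list_prod_mem_sup_pow (L := lieImage I V p)
        (List.ofFn fun j => piF I V p (TensorAlgebra.ι K (w' j))) fun a ha => by
          obtain ⟨j, rfl⟩ := List.mem_ofFn.1 ha
          exact ⟨w' j, rfl⟩
      rwa [List.length_ofFn] at h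
    have h4 : (List.ofFn fun j => piF I V p (TensorAlgebra.ι K (Fin.append w w' j))) =
        (List.ofFn fun j => piF I V p (TensorAlgebra.ι K (w j))) ++
          List.ofFn fun j => piF I V p (TensorAlgebra.ι K (w' j)) := by
      rw [← List.ofFn_fin_append]
      congr 1
      funext j
      refine Fin.addCases (fun i => ?_) (fun i => ?_) j <;> simp
    rw [h4, List.prod_append, Fin.prod_univ_add] at h3
    simp only [Fin.append_left, Fin.append_right] at h3
    have h5 := mul_mem_lower_right h1 hY
    have h6 := mul_mem_lower_left (symToRelFree_mem_sup_pow hI (prod_mem_symDeg m w)) h2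
    rw [mul_sub_eq_of_factors _ _ (List.ofFn fun j => piF I V p (TensorAlgebra.ι K (w j))).prod
      (List.ofFn fun j => piF I V p (TensorAlgebra.ι K (w' j))).prod]
    exact sub_mem (sub_mem h3 h5) h6
  have h1 : ∀ w : Fin m → CommSum K V p, symDeg K (CommSum K V p) n ≤
      (lower (lieImage I V p) (m + n)).comap
        (LinearMap.mulLeft K (symToRelFree I V p (∏ j, SymmetricAlgebra.ι K _ (w j))) ∘ₗ
            symToRelFree I V p -
          symToRelFree I V p ∘ₗ LinearMap.mulLeft K (∏ j, SymmetricAlgebra.ι K _ (w j))) :=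
    fun w => symDeg_le fun w' => key w w'
  have h2 : symDeg K (CommSum K V p) m ≤ (lower (lieImage I V p) (m + n)).comap
      (LinearMap.mulRight K (symToRelFree I V p b) ∘ₗ symToRelFree I V p -
        symToRelFree I V p ∘ₗ LinearMap.mulRight K b) :=
    symDeg_le fun w => h1 w hb
  exact h2 ha

/-- The surjectivity part of the Poincaré–Birkhoff–Witt theorem: a product is the image of the
corresponding element of the symmetric algebra up to products of fewer factors. -/
theorem lieImage_pow_le_map [CharZero K] {p : ℕ} (hI : VarietyLE I (lieNilpotent K p)) (n : ℕ) :
    lieImage I V p ^ n ≤ (symLT K (CommSum K V p) (n + 1)).map (symToRelFree I V p) := by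
  induction n using Nat.strong_induction_on with
  | _ n ih =>
    refine pow_le_of_prod_ofFn_mem _ _ _ fun m hm => ?_
    choose w hw using hm
    have h1 := prod_sub_symToRelFree_mem_lower hI w
    have h2 : lower (lieImage I V p) n ≤
        (symLT K (CommSum K V p) (n + 1)).map (symToRelFree I V p) := by
      cases n with
      | zero => exact bot_le
      | succ n =>
        refine (sup_pow_le_iSup_pow _ n).trans (iSup_le fun j => (ih j j.2).trans ?_)
        exact Submodule.map_mono (symLT_mono (by omega))
    have h3 : m = fun j => piF I V p (TensorAlgebra.ι K (w j)) := funext fun j => (hw j).symm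
    have h4 := add_mem (h2 h1)
      (Submodule.mem_map_of_mem (f := symToRelFree I V p)
        (symDeg_le_symLT n.lt_succ_self (prod_mem_symDeg n w)))
    rw [sub_add_cancel] at h4
    rwa [h3]

theorem lower_lieImage_le_map [CharZero K] {p : ℕ} (hI : VarietyLE I (lieNilpotent K p)) (n : ℕ) :
    lower (lieImage I V p) n ≤ (symLT K (CommSum K V p) n).map (symToRelFree I V p) := by
  cases n with
  | zero => exact bot_le
  | succ n =>
    refine (sup_pow_le_iSup_pow _ n).trans (iSup_le fun j => (lieImage_pow_le_map hI j).trans ?_)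
    exact Submodule.map_mono (symLT_mono (by omega))

end RelativelyFree

/-! ### Equivariance of symmetrization -/

section Equivariance

variable {K : Type u} [Field K] {W : Type v} [AddCommGroup W] [Module K W]

theorem symmetrization_symMap (g : W →ₗ[K] W) (a : SymmetricAlgebra K W) :
    symmetrization K W (symMap g a) = tensorMap g (symmetrization K W a) := by
  obtain ⟨n, hn⟩ := exists_mem_symLT a
  have h : symLT K W n ≤ LinearMap.eqLocus (symmetrization K W ∘ₗ (symMap g).toLinearMap)
      ((tensorMap g).toLinearMap ∘ₗ symmetrization K W) := by
    refine iSup_le fun j => symDeg_le fun w => ?_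
    rw [LinearMap.mem_eqLocus]
    simp only [LinearMap.comp_apply, AlgHom.toLinearMap_apply, map_prod, symMap,
      SymmetricAlgebra.lift_ι_apply]
    rw [symmetrization_prod, symmetrization_prod, map_smul, map_sum]
    congr 1
    refine Finset.sum_congr rfl fun σ _ => ?_
    rw [map_list_prod, List.map_ofFn]
    congr 2
    funext j
    simp [tensorMap]
  exact h hn

end Equivariance

section RelativelyFree

variable {K : Type u} [Field K] {I : Set (FreeAlgebra K ℕ)}
  {V : Type v} [AddCommGroup V] [Module K V]

theorem relFreeMap_nu (g : V →ₗ[K] V) (t : TensorAlgebra K V) :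
    relFreeMap I g (nu I V t) = nu I V (tensorMap g t) := by
  rw [relFreeMap]
  exact RingQuot.liftAlgHom_mkAlgHom_apply K _ _ _

theorem piF_tensorMap {p : ℕ} (g : V →ₗ[K] V) (t : TAlg K V p) :
    piF I V p (tensorMap (commSumMap p g) t) = relFreeMap I g (piF I V p t) := by
  have h : (piF I V p).comp (tensorMap (commSumMap p g)) =
      (relFreeMap I g).comp (piF I V p) := by
    refine TensorAlgebra.hom_ext (LinearMap.ext fun w => ?_)
    simp only [LinearMap.comp_apply, AlgHom.toLinearMap_apply, AlgHom.comp_apply, piF_ι, map_sum,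
      relFreeMap_nu]
    rw [tensorMap, TensorAlgebra.lift_ι_apply, LinearMap.comp_apply, piF_ι]
    rfl
  exact congrArg (fun f => f t) h

theorem symToRelFree_symMap {p : ℕ} (g : V →ₗ[K] V) (a : SAlg K V p) :
    symToRelFree I V p (symMap (commSumMap p g) a) = relFreeMap I g (symToRelFree I V p a) := by
  rw [symToRelFree, LinearMap.comp_apply, LinearMap.comp_apply, symmetrization_symMap]
  exact piF_tensorMap g _

/-! ### Degrees in the relatively free algebra -/

/-- The elements `x` of the relatively free algebra with `2x = 2^d x` for the action of the
scalar `2` induced from `V`. In characteristic `0`, these spaces are independent, so that they can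
be used to separate degrees. -/
noncomputable def scaleSpace (I : Set (FreeAlgebra K ℕ)) (V : Type v) [AddCommGroup V] [Module K V]
    (d : ℕ) : Submodule K (RelFree I V) :=
  Module.End.eigenspace (relFreeMap I ((2 : K) • (LinearMap.id : V →ₗ[K] V))).toLinearMap
    ((2 : K) ^ d)

theorem mem_scaleSpace {d : ℕ} {x : RelFree I V} : x ∈ scaleSpace I V d ↔
    relFreeMap I ((2 : K) • (LinearMap.id : V →ₗ[K] V)) x = (2 : K) ^ d • x :=
  Module.End.mem_eigenspace_iff

theorem two_pow_injective (K : Type*) [Field K] [CharZero K] :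
    Function.Injective fun d : ℕ => (2 : K) ^ d := by
  intro d e h
  refine Nat.pow_right_injective le_rfl ?_
  have h' : ((2 ^ d : ℕ) : K) = ((2 ^ e : ℕ) : K) := by push_cast; exact h
  exact Nat.cast_injective h'

theorem iSupIndep_scaleSpace [CharZero K] : iSupIndep (scaleSpace I V) :=
  (Module.End.eigenspaces_iSupIndep _).comp (two_pow_injective K)

theorem tpow_smul_id (d : ℕ) (c : K) (w : ⨂[K]^d V) :
    tpow d (c • (LinearMap.id : V →ₗ[K] V)) w = c ^ d • w := by
  have h : tpow d (c • (LinearMap.id : V →ₗ[K] V)) = c ^ d • LinearMap.id := by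
    ext v
    simp only [LinearMap.compMultilinearMap_apply, tpow_tprod, LinearMap.smul_apply,
      LinearMap.id_apply]
    rw [MultilinearMap.map_smul_univ]
    simp
  rw [h]
  rfl

theorem symToRelFree_natDeg_le (p d n : ℕ) :
    natDeg K V p d n ≤ (scaleSpace I V d).comap (symToRelFree I V p) := by
  refine iSup_le fun φ => ?_
  rintro _ ⟨w, rfl⟩
  rw [Submodule.mem_comap, mem_scaleSpace, ← symToRelFree_symMap, ← φ.2.1, tpow_smul_id,
    map_smul, map_smul]

theorem symMap_mem_natDeg {p d n : ℕ} (g : V →ₗ[K] V) {a : SAlg K V p}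
    (ha : a ∈ natDeg K V p d n) : symMap (commSumMap p g) a ∈ natDeg K V p d n := by
  have h : natDeg K V p d n ≤
      (natDeg K V p d n).comap (symMap (commSumMap p g)).toLinearMap := by
    refine iSup_le fun φ => ?_
    rintro _ ⟨w, rfl⟩
    rw [Submodule.mem_comap, AlgHom.toLinearMap_apply, ← φ.2.1]
    exact mem_natDeg φ.2 _
  exact h ha

theorem relFreeDeg_le_scaleSpace (d : ℕ) : relFreeDeg I V d ≤ scaleSpace I V d := by
  have h : LinearMap.range (TensorAlgebra.ι K : V →ₗ[K] TensorAlgebra K V) ^ d ≤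
      LinearMap.eqLocus (tensorMap ((2 : K) • (LinearMap.id : V →ₗ[K] V))).toLinearMap
        ((2 : K) ^ d • LinearMap.id) := by
    induction d with
    | zero =>
      rw [pow_zero, Submodule.one_le, LinearMap.mem_eqLocus]
      simp
    | succ d ih =>
      rw [pow_succ]
      refine Submodule.mul_le.2 ?_
      rintro a ha _ ⟨v, rfl⟩
      have h1 := ih ha
      rw [LinearMap.mem_eqLocus] at h1 ⊢
      simp only [AlgHom.toLinearMap_apply, LinearMap.smul_apply, LinearMap.id_apply] at h1 ⊢
      rw [map_mul, h1, pow_succ, mul_smul, smul_mul_assoc]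
      simp [tensorMap]
  rw [relFreeDeg, Submodule.map_le_iff_le_comap]
  intro t ht
  have h1 := h ht
  rw [LinearMap.mem_eqLocus] at h1
  simp only [AlgHom.toLinearMap_apply, LinearMap.smul_apply, LinearMap.id_apply] at h1
  rw [Submodule.mem_comap, AlgHom.toLinearMap_apply, mem_scaleSpace, relFreeMap_nu, h1, map_smul]

theorem eq_of_mem_relFreeDeg [CharZero K] {d e : ℕ} {x : RelFree I V} (hx : x ≠ 0)
    (hd : x ∈ relFreeDeg I V d) (he : x ∈ relFreeDeg I V e) : d = e := by
  by_contra h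
  have h1 := (iSupIndep_scaleSpace (I := I) (V := V)).pairwiseDisjoint h
  exact hx (Submodule.disjoint_def.1 h1 x (relFreeDeg_le_scaleSpace d hd)
    (relFreeDeg_le_scaleSpace e he))

/-! ### Lifting invariants to the symmetric algebra -/

/-- Every invariant in the span of the products of fewer than `n` elements of `V^{[≤p]}` is the
image of an invariant in `S(V^{[≤p]})` of degree less than `n`. No reductivity of `G` is needed,
because both sides are acted upon by all endomorphisms of `V`; the degrees in `V` are first
separated by means of the action of the scalar `2`, and `exists_invariant_lift` applies to each
of them. -/
theorem exists_invariant_mem_symLT [CharZero K] [Module.Finite K V] {p : ℕ}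
    (hI : VarietyLE I (lieNilpotent K p)) {G : Type w} [Group G] (ρ : Representation K G V)
    {n : ℕ} {x : RelFree I V} (hx : x ∈ lower (lieImage I V p) n) (hG : x ∈ FInv ρ I) :
    ∃ a ∈ symLT K (CommSum K V p) n, a ∈ SInv ρ p ∧ symToRelFree I V p a = x := by
  have hG' : ∀ g, relFreeMap I (ρ g) x = x := (mem_fixedSubalgebra _ x).1 hG
  let X : ℕ → Type _ := fun d => Σ j : Fin n, NatMap K V p d j
  let D : ℕ → Submodule K (SAlg K V p) := fun d => ⨆ y : X d, LinearMap.range y.2.1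
  have hD : ∀ d, D d = ⨆ j : Fin n, natDeg K V p d j := fun d => iSup_sigma
  have hDS : ∀ d, D d ≤ (scaleSpace I V d).comap (symToRelFree I V p) := fun d => by
    rw [hD]
    exact iSup_le fun j => symToRelFree_natDeg_le p d j
  have hDG : ∀ d g, D d ≤ (D d).comap (symMap (commSumMap p g)).toLinearMap := fun d g => by
    rw [hD]
    refine iSup_le fun j a ha => ?_
    exact Submodule.mem_iSup_of_mem j (symMap_mem_natDeg g ha)
  have hDL : ∀ d, D d ≤ symLT K (CommSum K V p) n := fun d => by
    refine iSup_le fun y => ?_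
    rintro _ ⟨w, rfl⟩
    exact symDeg_le_symLT y.1.2 (y.2.2.2 w)
  obtain ⟨s, hs, rfl⟩ := lower_lieImage_le_map hI n hx
  have hs' : s ∈ ⨆ d, D d := by
    have h : symLT K (CommSum K V p) n ≤ ⨆ d, D d := by
      refine iSup_le fun j => (symDeg_le_iSup_natDeg p j).trans (iSup_mono fun d => ?_)
      rw [hD]
      exact le_iSup (fun j : Fin n => natDeg K V p d j) j
    exact h hs
  obtain ⟨c, hc, rfl⟩ := (Submodule.mem_iSup_iff_exists_finsupp _ _).1 hs'
  -- the components of different degrees are separately invariant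
  have hinv : ∀ d ∈ c.support, ∀ g, relFreeMap I (ρ g) (symToRelFree I V p (c d)) =
      symToRelFree I V p (c d) := by
    intro d hd g
    refine (iSupIndep_iff_finsetSum_eq_imp_eq _).1 (iSupIndep_scaleSpace (I := I) (V := V))
      c.support (fun d => relFreeMap I (ρ g) (symToRelFree I V p (c d)))
      (fun d => symToRelFree I V p (c d)) (fun d _ => ⟨?_, hDS d (hc d)⟩) ?_ d hd
    · rw [← symToRelFree_symMap]
      exact hDS d (hDG d _ (hc d))
    · rw [← map_sum, ← map_sum]
      exact hG' g
  have hlift : ∀ d, ∃ a ∈ D d, (∀ g, symMap (commSumMap p (ρ g)) a = a) ∧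
      (d ∈ c.support → symToRelFree I V p a = symToRelFree I V p (c d)) := by
    intro d
    by_cases hd : d ∈ c.support
    · obtain ⟨a, ha, haG, hac⟩ := exists_invariant_lift d
        (fun g => (symMap (commSumMap p g)).toLinearMap)
        (fun g => (relFreeMap I g).toLinearMap) (symToRelFree I V p)
        (fun g s => symToRelFree_symMap g s) (fun y : X d => y.2.1)
        (fun y g w => y.2.2.1 g w) (Set.range ρ) (c d) (hc d) (by
          rintro _ ⟨g, rfl⟩
          exact hinv d hd g)
      exact ⟨a, ha, fun g => haG _ ⟨g, rfl⟩, fun _ => hac⟩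
    · exact ⟨0, zero_mem _, fun g => map_zero _, fun h => (hd h).elim⟩
  choose a haD haG hac using hlift
  refine ⟨∑ d ∈ c.support, a d, sum_mem fun d _ => hDL d (haD d), ?_, ?_⟩
  · refine sum_mem fun d _ => ?_
    exact (mem_fixedSubalgebra _ _).2 (haG d)
  · rw [map_sum, Finset.sum_congr rfl fun d hd => hac d hd, ← map_sum]
    rfl

/-! ### Multihomogeneous elements -/

theorem SMulti_le_symDeg {p : ℕ} (α : Fin p → ℕ) :
    SMulti K V α ≤ symDeg K (CommSum K V p) (∑ i, α i) := by
  refine Submodule.span_le.2 ?_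
  rintro _ ⟨n, c, w, hc, rfl⟩
  have hn : n = ∑ i, α i := by
    have h := Finset.card_eq_sum_card_fiberwise (s := Finset.univ) (t := Finset.univ) (f := c)
      fun _ _ => Finset.mem_coe.2 (Finset.mem_univ _)
    rw [Finset.card_univ, Fintype.card_fin] at h
    rw [h]
    exact Finset.sum_congr rfl fun i _ => hc i
  rw [← hn]
  exact prod_mem_symDeg n _

theorem symmetrization_mem_TMulti {p : ℕ} {α : Fin p → ℕ} {a : SAlg K V p}
    (ha : a ∈ SMulti K V α) : symmetrization K _ a ∈ TMulti K V α := by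
  have h : SMulti K V α ≤ (TMulti K V α).comap (symmetrization K _) := by
    refine Submodule.span_le.2 ?_
    rintro _ ⟨n, c, w, hc, rfl⟩
    rw [SetLike.mem_coe, Submodule.mem_comap, symmetrization_prod]
    refine Submodule.smul_mem _ _ (sum_mem fun σ _ => Submodule.subset_span ?_)
    refine ⟨n, c ∘ σ, fun j => w (σ j), fun i => ?_, rfl⟩
    rw [← hc i]
    refine Finset.card_equiv σ fun j => ?_
    simp
  exact h ha

theorem piF_mem_relFreeDeg {p : ℕ} {α : Fin p → ℕ} {t : TAlg K V p} (ht : t ∈ TMulti K V α) :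
    piF I V p t ∈ relFreeDeg I V (∑ i : Fin p, ((i : ℕ) + 1) * α i) := by
  let R : Submodule K (TensorAlgebra K V) := LinearMap.range (TensorAlgebra.ι K)
  have hcomm : ∀ i, commSpace K V i ≤ R ^ (i + 1) := by
    intro i
    refine Submodule.span_le.2 ?_
    rintro _ ⟨u, rfl⟩
    induction i with
    | zero =>
      rw [SetLike.mem_coe, zero_add, pow_one]
      exact ⟨u 0, rfl⟩
    | succ i ih =>
      have hu : TensorAlgebra.ι K (u (i + 1)) ∈ R := ⟨_, rfl⟩
      refine sub_mem ?_ ?_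
      · rw [pow_succ]
        exact Submodule.mul_mem_mul ih hu
      · rw [pow_succ']
        exact Submodule.mul_mem_mul hu ih
  have hprod : ∀ (n : ℕ) (c : Fin n → Fin p) (w : (j : Fin n) → commSpace K V (c j)),
      piT K V p (List.ofFn fun j => TensorAlgebra.ι K (incl p (c j) (w j))).prod ∈
        R ^ ∑ j, ((c j : ℕ) + 1) := by
    intro n
    induction n with
    | zero =>
      intro c w
      simp only [List.ofFn_zero, List.prod_nil, map_one, Finset.univ_eq_empty, Finset.sum_empty,
        pow_zero]
      exact Submodule.one_le.1 le_rfl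
    | succ n ih =>
      intro c w
      rw [List.ofFn_succ, List.prod_cons, map_mul, Fin.sum_univ_succ, pow_add]
      refine Submodule.mul_mem_mul ?_ (ih (fun j => c j.succ) fun j => w j.succ)
      have h : piT K V p (TensorAlgebra.ι K (incl p (c 0) (w 0))) = w 0 := by
        simp only [piT, TensorAlgebra.lift_ι_apply, LinearMap.sum_apply, LinearMap.comp_apply,
          LinearMap.proj_apply]
        rw [Finset.sum_eq_single (c 0)]
        · simp [incl]
        · intro j _ hj
          simp [incl, hj]
        · simp
      rw [h]
      exact hcomm _ (w 0).2
  have hle : TMulti K V α ≤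
      (R ^ ∑ i : Fin p, ((i : ℕ) + 1) * α i).comap (piT K V p).toLinearMap := by
    refine Submodule.span_le.2 ?_
    rintro _ ⟨n, c, w, hc, rfl⟩
    have hsum : ∑ i : Fin p, ((i : ℕ) + 1) * α i = ∑ j, ((c j : ℕ) + 1) := by
      rw [← Finset.sum_fiberwise Finset.univ c]
      refine Finset.sum_congr rfl fun i _ => ?_
      rw [Finset.sum_congr rfl fun j hj => by rw [(Finset.mem_filter.1 hj).2], Finset.sum_const,
        hc i, smul_eq_mul, mul_comm]
    rw [SetLike.mem_coe, Submodule.mem_comap, hsum]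
    exact hprod n c w
  exact Submodule.mem_map_of_mem (f := (nu I V).toLinearMap) (hle ht)

/-! ### Generators of the invariants -/

theorem symToRelFree_mem_FInv {p : ℕ} {G : Type w} [Group G] (ρ : Representation K G V)
    {a : SAlg K V p} (ha : a ∈ SInv ρ p) : symToRelFree I V p a ∈ FInv ρ I := by
  refine (mem_fixedSubalgebra _ _).2 fun g => ?_
  rw [← symToRelFree_symMap]
  exact congrArg _ ((mem_fixedSubalgebra _ _).1 ha g)

theorem symProj_mem_SInv {p : ℕ} {G : Type w} [Group G] (ρ : Representation K G V) (n : ℕ)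
    {a : SAlg K V p} (ha : a ∈ SInv ρ p) : symProj K (CommSum K V p) n a ∈ SInv ρ p := by
  refine (mem_fixedSubalgebra _ _).2 fun g => ?_
  rw [← symProj_symMap]
  exact congrArg _ ((mem_fixedSubalgebra _ _).1 ha g)

/-- The generation statement for a generating system that is homogeneous for the coarse grading
of `S(V^{[≤p]})` by the number of factors. By induction on this degree, the image of an invariant
of `S(V^{[≤p]})` is a polynomial in the images of the generators, up to invariants of lower degree,
which lift to `S(V^{[≤p]})` again. -/
theorem adjoin_symToRelFree_eq_FInv [CharZero K] [Module.Finite K V] {p : ℕ}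
    (hI : VarietyLE I (lieNilpotent K p)) {G : Type w} [Group G] (ρ : Representation K G V)
    {Λ : Type x} (f : Λ → SAlg K V p) (δ : Λ → ℕ)
    (hf : ∀ l, f l ∈ symDeg K (CommSum K V p) (δ l))
    (hgen : Algebra.adjoin K (Set.range f) = SInv ρ p) :
    Algebra.adjoin K (Set.range fun l => symToRelFree I V p (f l)) = FInv ρ I := by
  let Φ := symToRelFree I V p
  let B := Algebra.adjoin K (Set.range fun l => Φ (f l))
  have hfG : ∀ l, f l ∈ SInv ρ p := fun l => hgen ▸ Algebra.subset_adjoin ⟨l, rfl⟩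
  have hBF : B ≤ FInv ρ I := by
    refine Algebra.adjoin_le ?_
    rintro _ ⟨l, rfl⟩
    exact symToRelFree_mem_FInv ρ (hfG l)
  -- a monomial in the generators is represented in `B` up to products of fewer factors
  have hmon : ∀ m ∈ Submonoid.closure (Set.range f), ∃ n, m ∈ symDeg K (CommSum K V p) n ∧
      m ∈ SInv ρ p ∧ ∃ b ∈ B, b - Φ m ∈ lower (lieImage I V p) n := by
    intro m hm
    induction hm using Submonoid.closure_induction_left with
    | one =>
      refine ⟨0, ?_, one_mem _, 1, one_mem _, ?_⟩
      · rw [symDeg, pow_zero]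
        exact Submodule.one_le.1 le_rfl
      · have h := prod_sub_symToRelFree_mem_lower hI (Fin.elim0 : Fin 0 → CommSum K V p)
        simpa using h
    | mul_left y hy m _ ih =>
      obtain ⟨l, rfl⟩ := hy
      obtain ⟨n, hn, hG, b, hb, hbm⟩ := ih
      refine ⟨δ l + n, mul_mem_symDeg (hf l) hn, mul_mem (hfG l) hG, Φ (f l) * b,
        mul_mem (Algebra.subset_adjoin ⟨l, rfl⟩) hb, ?_⟩
      have h1 := mul_mem_lower_left (symToRelFree_mem_sup_pow hI (hf l)) hbm
      have h2 := symToRelFree_mul_sub_mem_lower hI (hf l) hn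
      have h3 := add_mem h1 h2
      rwa [mul_sub, sub_add_sub_cancel] at h3
  have hproj : ∀ n, ∀ a ∈ SInv ρ p, ∃ b ∈ B,
      b - Φ (symProj K (CommSum K V p) n a) ∈ lower (lieImage I V p) n := by
    intro n a ha
    rw [← hgen, ← Subalgebra.mem_toSubmodule, Algebra.adjoin_eq_span] at ha
    induction ha using Submodule.span_induction with
    | mem m hm =>
      obtain ⟨k, hk, -, b, hb, hbm⟩ := hmon m hm
      rw [symProj_of_mem n hk]
      split_ifs with h
      · exact ⟨b, hb, h ▸ hbm⟩
      · exact ⟨0, zero_mem _, by simp⟩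
    | zero => exact ⟨0, zero_mem _, by simp⟩
    | add a a' _ _ h h' =>
      obtain ⟨b, hb, hba⟩ := h
      obtain ⟨b', hb', hba'⟩ := h'
      refine ⟨b + b', add_mem hb hb', ?_⟩
      rw [map_add, map_add, add_sub_add_comm]
      exact add_mem hba hba'
    | smul r a _ h =>
      obtain ⟨b, hb, hba⟩ := h
      refine ⟨r • b, B.smul_mem hb r, ?_⟩
      have h := Submodule.smul_mem _ r hba
      rwa [smul_sub, ← map_smul, ← map_smul] at h
  have hmain : ∀ n, ∀ a ∈ SInv ρ p, Φ (symProj K (CommSum K V p) n a) ∈ B := by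
    intro n
    induction n using Nat.strong_induction_on with
    | _ n ih =>
      intro a ha
      obtain ⟨b, hb, hba⟩ := hproj n a ha
      obtain ⟨c, hc, hcG, hcb⟩ := exists_invariant_mem_symLT hI ρ hba
        (sub_mem (hBF hb) (symToRelFree_mem_FInv ρ (symProj_mem_SInv ρ n ha)))
      have h : Φ c ∈ B := by
        rw [← sum_symProj_of_mem_symLT hc, map_sum]
        exact sum_mem fun j hj => ih j (Finset.mem_range.1 hj) c hcG
      have h2 := sub_mem hb h
      rw [show Φ c = _ from hcb, sub_sub_cancel] at h2
      exact h2
  refine le_antisymm hBF fun x hx => ?_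
  obtain ⟨n, hn⟩ := exists_mem_lower_lieImage hI x
  obtain ⟨a, ha, haG, rfl⟩ := exists_invariant_mem_symLT hI ρ hn hx
  change Φ a ∈ B
  rw [← sum_symProj_of_mem_symLT ha, map_sum]
  exact sum_mem fun j _ => hmain j a haG

end RelativelyFree

end RelFreeInv

theorem mainTheorem1 {K : Type u} [Field K] [CharZero K]
    (p : ℕ) (hp : 1 ≤ p)
    (I : Set (FreeAlgebra K ℕ)) (hI : RelFreeInv.VarietyLE I (RelFreeInv.lieNilpotent K p))
    {V : Type v} [AddCommGroup V] [Module K V] [Module.Finite K V]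
    {G : Type w} [Group G] (ρ : Representation K G V)
    {Λ : Type x} (f : Λ → RelFreeInv.SAlg K V p) (α : Λ → Fin p → ℕ)
    (hf : ∀ l, f l ∈ RelFreeInv.SMulti K V (α l))
    (hgen : Algebra.adjoin K (Set.range f) = RelFreeInv.SInv ρ p) :
    -- the symmetrizations are invariants in `T` of the same multidegrees
    (∀ l, RelFreeInv.symmetrization K _ (f l) ∈ RelFreeInv.TMulti K V (α l) ∧
      RelFreeInv.symmetrization K _ (f l) ∈ RelFreeInv.TInv ρ p) ∧
    -- their images generate `F^G`
    Algebra.adjoin K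
        (Set.range fun l => RelFreeInv.piF I V p (RelFreeInv.symmetrization K _ (f l))) =
      RelFreeInv.FInv ρ I ∧
    -- the images are homogeneous of degree `∑ i α_{λ,i}`, and of no other degree if nonzero
    (∀ l, RelFreeInv.piF I V p (RelFreeInv.symmetrization K _ (f l)) ∈
        RelFreeInv.relFreeDeg I V (∑ i : Fin p, ((i : ℕ) + 1) * α l i) ∧
      (RelFreeInv.piF I V p (RelFreeInv.symmetrization K _ (f l)) ≠ 0 →
        ∀ d, RelFreeInv.piF I V p (RelFreeInv.symmetrization K _ (f l)) ∈
          RelFreeInv.relFreeDeg I V d → d = ∑ i : Fin p, ((i : ℕ) + 1) * α l i)) := by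
  open RelFreeInv in
  have hdeg := fun l => piF_mem_relFreeDeg (I := I) (symmetrization_mem_TMulti (hf l))
  refine ⟨fun l => ⟨symmetrization_mem_TMulti (hf l), ?_⟩,
    adjoin_symToRelFree_eq_FInv hI ρ f _ (fun l => SMulti_le_symDeg _ (hf l)) hgen,
    fun l => ⟨hdeg l, fun h0 d hd => eq_of_mem_relFreeDeg h0 hd (hdeg l)⟩⟩
  have hl : f l ∈ SInv ρ p := hgen ▸ Algebra.subset_adjoin ⟨l, rfl⟩
  refine (mem_fixedSubalgebra _ _).2 fun g => ?_
  rw [← symmetrization_symMap]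
  exact congrArg _ ((mem_fixedSubalgebra _ _).1 hl g)
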